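/- **Setting.** Let $X$ be an irreducible sofic shift (two-sided, finite alphabet), $Y$ a shift space over a finite alphabet, and $\pi\colon X\to Y$ a finite-to-one factor code, that is, a continuous shift-commuting surjection all of whose fibers are finite. Write $T$ for the shift on $X$. A point of a shift space is doubly transitive if every word of the language occurs in it infinitely often to the left and to the right; the degree $d_\pi$ is the number such that each doubly transitive point of $Y$ has exactly $d_\pi$ preimages. All measures are Borel probability measures. An $n$-fold *relative joining* is a $(T\times\dots\times T)$-invariant measure $\lambda$ on $X^n$ such that $\pi(x_1)=\dots=\pi(x_n)$ for $\lambda$-a.e. $(x_1,\dots,x_n)$; it is *separating* if $x_1,\dots,x_n$ are distinct for $\lambda$-a.e. $(x_1,\dots,x_n)$. Its margins are the images $p_i\lambda$ of $\lambda$ under the coordinate projections $p_i\colon X^n\to X$, and it is a relative joining of $\mu_1,\dots,\mu_n$ if $p_i\lambda=\mu_i$ for all $i$. It is a joining over $\nu$ if $\pi p_i\lambda=\nu$ for some $i$ (hence, when $n\ge 1$, for all $i$). A *degree joining* over $\nu$ is an ergodic $d_\pi$-fold separating relative joining over $\nu$. For a fully supported ergodic measure $\mu$ on $X$, its *multiplicity*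 is $m=\#\{i: 1\le i\le d_\pi,\ p_i\lambda=\mu\}$, where $\lambda$ is a degree joining over $\pi\mu$. **Theorem.** Let $\mu$ be a fully supported ergodic measure on $X$. Then its multiplicity $m$ is well defined (a degree joining over $\pi\mu$ exists, and the number $m$ is the same for all of them). Let $G_\mu$ be the set of points $x\in X$ generic for $\mu$, i.e. such that $\frac1N\sum_{i<N} f(T^ix)\to\int f\,d\mu$ for every continuous $f\colon X\to\mathbb R$. A disintegration of $\mu$ over $Y$ exists, i.e. a measurable family $\{\mu_y\}_{y\in Y}$ of probability measures on $X$ with $\mu=\int\mu_y\,d(\pi\mu)(y)$ and $\mu_y(\pi^{-1}(y))=1$ for $\pi\mu$-a.e. $y$, and for every such disintegration the statements (1) and (3) below hold; statement (2) holds as well. 1. For $\pi\mu$-a.e. $y$, the set $G_\mu\cap\pi^{-1}(y)$ has exactly $m$ points and $\mu_y$ is the uniform distribution on it. 2. $m$ is the largest number $n$ such that there is an $n$-fold separating relative joining of $\mu,\dots,\mu$. 3. The relatively independent joining $\mu\otimes_{\pi\mu}\mu:=\int_Y\mu_y\otimes\mu_y\,d(\pi\mu)(y)$ satisfies $(\mu\otimes_{\pi\mu}\mu)\{(x,x'):x=x'\}=\frac1m$.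 -/

import Mathlib

open MeasureTheory ProbabilityTheory Filter Topology
open SymbolicDynamics.FullShift (Subshift shift)
open scoped ENNReal

namespace SoficMultiplicity

/-! ### Shift spaces -/

section Shifts

variable {A B : Type*} [TopologicalSpace A] [TopologicalSpace B]

/-- The (two-sided) shift map `(T x) i = x (i + 1)` on a shift space. The ambient Mathlib shift is
`shift g x = fun h => x (g + h)`. -/
def shiftMap (X : Subshift A ℤ) : X.carrier → X.carrier :=
  (X.mapsTo 1).restrict (shift (1 : ℤ)) X.carrier X.carrier

/-- The word `w` occurs in the bi-infinite sequence `x`, starting at position `i`. -/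
def WordAt (x : ℤ → A) (w : List A) (i : ℤ) : Prop :=
  ∀ k : Fin w.length, x (i + (k : ℕ)) = w.get k

/-- The language of a shift space: all finite words occurring in its points. -/
def language (X : Subshift A ℤ) : Set (List A) :=
  {w | ∃ x ∈ X.carrier, ∃ i : ℤ, WordAt x w i}

/-- Irreducibility: any two words of the language can be joined by a third one within it. -/
def IsIrreducible (X : Subshift A ℤ) : Prop :=
  ∀ u ∈ language X, ∀ w ∈ language X, ∃ v : List A, u ++ v ++ w ∈ language X

/-- A sofic shift: the set of label sequences of all bi-infinite paths in a finite directed graph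
with edges labelled by `A`. Here `E p a q` says that there is an edge from `p` to `q` with
label `a`. -/
def IsSofic (X : Subshift A ℤ) : Prop :=
  ∃ (n : ℕ) (E : Fin n → A → Fin n → Prop),
    X.carrier = {x | ∃ v : ℤ → Fin n, ∀ i : ℤ, E (v i) (x i) (v (i + 1))}

/-- A point is doubly transitive if every word of the language occurs in it infinitely often to
the right and infinitely often to the left. -/
def IsDoublyTransitive (X : Subshift A ℤ) (x : X.carrier) : Prop :=
  ∀ w ∈ language X,
    (∀ N : ℤ, ∃ i : ℤ, N ≤ i ∧ WordAt x.1 w i) ∧ (∀ N : ℤ, ∃ i : ℤ, i ≤ N ∧ WordAt x.1 w i)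

/-- A factor code: a continuous surjection between shift spaces commuting with the shifts. -/
structure IsFactorCode {X : Subshift A ℤ} {Y : Subshift B ℤ} (π : X.carrier → Y.carrier) :
    Prop where
  continuous : Continuous π
  surjective : Function.Surjective π
  semiconj : Function.Semiconj π (shiftMap X) (shiftMap Y)

/-- A map is finite-to-one if all its fibers are finite. -/
def IsFiniteToOne {X Y : Type*} (π : X → Y) : Prop :=
  ∀ y : Y, (π ⁻¹' {y}).Finite

/-- The degree of a finite-to-one factor code: the number `d` such that each doubly transitive
point of `Y` has exactly `d` preimages. -/
noncomputable def degree {X : Subshift A ℤ} {Y : Subshift B ℤ} (π : X.carrier → Y.carrier) : ℕ :=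
  sInf {d : ℕ | ∀ y : Y.carrier, IsDoublyTransitive Y y → (π ⁻¹' {y}).encard = d}

end Shifts

/-! ### Relative joinings -/

section Joinings

variable {X Y : Type*} [MeasurableSpace X] [MeasurableSpace Y]

/-- The diagonal self-map `T × ⋯ × T` of `X ^ n`. -/
def diagMap (T : X → X) (n : ℕ) : (Fin n → X) → (Fin n → X) := fun x i => T (x i)

/-- An `n`-fold `π`-relative joining: an invariant probability measure on `X ^ n` giving full
measure to the set of tuples all of whose entries have the same image under `π`. -/
structure IsRelJoining (T : X → X) (π : X → Y) (n : ℕ) (J : Measure (Fin n → X)) : Prop where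
  prob : IsProbabilityMeasure J
  invariant : MeasurePreserving (diagMap T n) J J
  same_image : ∀ᵐ x ∂J, ∀ i j : Fin n, π (x i) = π (x j)

/-- A measure on `X ^ n` is separating if almost every tuple consists of distinct points. -/
def IsSeparating {n : ℕ} (J : Measure (Fin n → X)) : Prop :=
  ∀ᵐ x ∂J, Function.Injective x

/-- The `i`-th margin of a measure on `X ^ n`. -/
noncomputable def margin {n : ℕ} (J : Measure (Fin n → X)) (i : Fin n) : Measure X :=
  J.map (fun x => x i)

/-- `κ` is a disintegration `y ↦ μ_y` of `μ` over `Y` via `π`: the `μ_y` are probability measures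
depending measurably on `y`, `μ = ∫ μ_y d(πμ)(y)`, and `μ_y` is concentrated on `π⁻¹(y)` for
`πμ`-almost every `y`. -/
structure IsDisintegration (π : X → Y) (μ : Measure X) (κ : Kernel Y X) : Prop where
  markov : IsMarkovKernel κ
  bind_eq : (μ.map π).bind κ = μ
  fiber : ∀ᵐ y ∂(μ.map π), κ y (π ⁻¹' {y}) = 1

/-- The relatively independent self-joining `μ ⊗_{πμ} μ = ∫ μ_y ⊗ μ_y d(πμ)(y)`, where
`y ↦ μ_y` is the disintegration `κ` of `μ` over `Y`. -/
noncomputable def relIndepSelfJoining (π : X → Y) (μ : Measure X) (κ : Kernel Y X) :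
    Measure (X × X) :=
  (μ.map π).bind (κ ×ₖ κ)

/-- The set of points generic for `μ`: the Birkhoff averages of every continuous function
converge to its integral. -/
def genericPoints [TopologicalSpace X] (T : X → X) (μ : Measure X) : Set X :=
  {x | ∀ f : C(X, ℝ), Tendsto (fun n => birkhoffAverage ℝ T f n x) atTop (𝓝 (∫ z, f z ∂μ))}

end Joinings

/-! ### Degree joinings and multiplicity -/

section Multiplicity

variable {A B : Type*} [TopologicalSpace A] [MeasurableSpace A]
  [TopologicalSpace B] [MeasurableSpace B]

/-- A degree joining over `ν`: an ergodic separating relative joining over `ν`, with as many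
factors as the degree of `π`. -/
structure IsDegreeJoining {X : Subshift A ℤ} {Y : Subshift B ℤ} (π : X.carrier → Y.carrier)
    (ν : Measure Y.carrier) (J : Measure (Fin (degree π) → X.carrier)) : Prop where
  relJoining : IsRelJoining (shiftMap X) π (degree π) J
  image : ∃ i, (margin J i).map π = ν
  ergodic : Ergodic (diagMap (shiftMap X) (degree π)) J
  separating : IsSeparating J

/-- `m` is the multiplicity of `μ` with respect to `π`: the number of times that `μ` appears as
a margin in a degree joining over `πμ`. This includes that the notion is well defined: there is
such a joining, and the number is the same for all of them. -/
def IsMultiplicity {X : Subshift A ℤ} {Y : Subshift B ℤ} (π : X.carrier → Y.carrier)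
    (μ : Measure X.carrier) (m : ℕ) : Prop :=
  (∃ J, IsDegreeJoining π (μ.map π) J) ∧
    ∀ J, IsDegreeJoining π (μ.map π) J → {i | margin J i = μ}.ncard = m

end Multiplicity

end SoficMultiplicity

/-!
Two ingredients carry the result: the fibers of `π` over doubly transitive points of `Y` all have
the same number `degree π` of elements, and almost every point of `Y` is doubly transitive.

**Constancy of the degree** (`IsFactorCode.encard_fiber_eq_degree`). A sofic shift with a doubly
transitive point is the image of a one-step Markov shift with a transitive point under a
finite-to-one one-block code (`exists_transitive_cover`), so it is enough to count preimages for
finite-to-one block codes `Φ` on a Markov shift `W` with a transitive point `h`. Two points of a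
fiber which agree on two windows agree in between: otherwise a copy of the difference could be
inserted at infinitely many places of `h`, and the fiber of `Φ h` would be infinite
(`eq_between_of_agree`). If `z` is recurrent in both directions, then distinct points over `z` do
not agree on any window (`IsTransitiveCode.eq_of_agree`). To see this, consider the self-maps of the
fiber which are limits of shifts to the right. They form a finite semigroup, hence contain an
idempotent `e`. Every point `x` is right asymptotic to `e x`, and by counting also left asymptotic
to some point in the image of `e`. As no point passes from one point in the image to another
(`IsTransitiveCode.no_transit`), `e` is the identity; and distinct points in the image of `e` agree
on no window. Limit maps between fibers over recurrent points are therefore injective, so that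
fibers over points which approach each other have the same cardinality. That preimages of doubly
transitive points visit everything is proved by counting the preimages which do not
(`IsTransitiveCode.sees`).

**Measures.** By recurrence and ergodicity, almost every point is doubly transitive for a fully
supported ergodic measure (`ae_isDoublyTransitive`); this applies to `μ` and to its image `ν` in
`Y`. Hence `ν`-almost every fiber has `d = degree π` points. Its enumerations form a finite set
depending measurably on the base point, and the ergodic measure `ν` lifts along this finite-to-one
extension to an ergodic measure, which is a degree joining
(`exists_ergodic_separating_joining`, from `exists_ergodic_lift`).

For a degree joining `J`, almost every tuple lists a whole fiber, and by Birkhoff's theorem each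
entry is generic for the corresponding margin. The points in the fiber generic for `μ` are thus the
entries at the coordinates whose margin is `μ` (`ae_generic_fiber_eq_image`). So the number `m` of
such coordinates is the number of generic points in almost every fiber, which does not depend on
`J`, and integrating the counting measures on these points gives `m • μ`
(`lintegral_fiberCount_generic`). Consequently the uniform distributions on them disintegrate
`μ`, and they are the only disintegration up to null sets (`IsDisintegration.ae_eq`). The
measure of the diagonal follows. Any separating joining of copies of `μ` consists of distinct
generic points in a fiber, hence has at most `m` factors, and `m` is attained by restricting `J` to
the coordinates with margin `μ`.
-/

namespace SoficMultiplicity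

/-! ### Finite-to-one local codes on one-step Markov shifts -/

section Codes

variable {S B : Type*}

/-- Two sequences agree on the window of radius `r` centred at position `i`. -/
def Agree (r : ℕ) (g g' : ℤ → S) (i : ℤ) : Prop :=
  ∀ k : ℤ, -(r : ℤ) ≤ k → k ≤ r → g (i + k) = g' (i + k)

/-- Arbitrarily long central windows of `z'` occur arbitrarily far to the right in `z`. -/
def RVisits (z z' : ℤ → S) : Prop :=
  ∀ N : ℕ, ∃ m : ℤ, N ≤ m ∧ ∀ i : ℤ, -(N : ℤ) ≤ i → i ≤ N → z (m + i) = z' i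

/-- Arbitrarily long central windows of `z'` occur arbitrarily far to the left in `z`. -/
def LVisits (z z' : ℤ → S) : Prop :=
  ∀ N : ℕ, ∃ m : ℤ, m ≤ -N ∧ ∀ i : ℤ, -(N : ℤ) ≤ i → i ≤ N → z (m + i) = z' i

/-- Arbitrarily long central windows of `z'` occur in `z`. -/
def Sees (z z' : ℤ → S) : Prop :=
  ∀ N : ℕ, ∃ m : ℤ, ∀ i : ℤ, -(N : ℤ) ≤ i → i ≤ N → z (m + i) = z' i

/-- A one-step Markov shift: a shift-invariant set of sequences, closed under limits, in which
two sequences with the same symbol at `a` can be spliced at `a`. -/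
structure IsMarkovShift (W : Set (ℤ → S)) : Prop where
  shift_mem : ∀ g ∈ W, ∀ m : ℤ, (fun i => g (m + i)) ∈ W
  closed : ∀ g, (∀ N : ℕ, ∃ g' ∈ W, ∀ i : ℤ, -(N : ℤ) ≤ i → i ≤ N → g' i = g i) → g ∈ W
  splice : ∀ g ∈ W, ∀ g' ∈ W, ∀ a : ℤ, g a = g' a → (fun i => if i < a then g i else g' i) ∈ W

/-- A sliding block code on `W` of window radius `r`. Comparing windows at two different positions
makes this a locality and a shift-equivariance condition at once. -/
def IsLocalOn (r : ℕ) (W : Set (ℤ → S)) (Φ : (ℤ → S) → ℤ → B) : Prop :=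
  ∀ g ∈ W, ∀ g' ∈ W, ∀ i j : ℤ,
    (∀ k : ℤ, -(r : ℤ) ≤ k → k ≤ r → g (i + k) = g' (j + k)) → Φ g i = Φ g' j

/-- The fiber over `z` of the restriction of `Φ` to `W`. -/
def fiberOn (W : Set (ℤ → S)) (Φ : (ℤ → S) → ℤ → B) (z : ℤ → B) : Set (ℤ → S) :=
  {g | g ∈ W ∧ Φ g = z}

/-- The sequence following `g` strictly before `a` and `u` from `a` on. -/
def cut (a : ℤ) (g u : ℤ → S) : ℤ → S := fun i => if i < a then g i else u i

lemma cut_of_lt {a i : ℤ} (g u : ℤ → S) (h : i < a) : cut a g u i = g i := if_pos h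

lemma cut_of_le {a i : ℤ} (g u : ℤ → S) (h : a ≤ i) : cut a g u i = u i := if_neg (by omega)

variable {r : ℕ} {W : Set (ℤ → S)} {Φ : (ℤ → S) → ℤ → B}

lemma Agree.symm {g g' : ℤ → S} {i : ℤ} (h : Agree r g g' i) : Agree r g' g i :=
  fun k h1 h2 => (h k h1 h2).symm

lemma Agree.trans {g g' g'' : ℤ → S} {i : ℤ} (h : Agree r g g' i) (h' : Agree r g' g'' i) :
    Agree r g g'' i :=
  fun k h1 h2 => (h k h1 h2).trans (h' k h1 h2)

lemma agree_cut_left {g u : ℤ → S} {a i : ℤ} (h : Agree r g u a) (hi : i ≤ a) :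
    Agree r (cut a g u) g i := by
  intro k h1 h2
  rcases lt_or_ge (i + k) a with hlt | hge
  · exact cut_of_lt _ _ hlt
  · have := h (i + k - a) (by omega) (by omega)
    rw [show a + (i + k - a) = i + k by ring] at this
    rw [cut_of_le _ _ hge, this]

lemma agree_cut_right {g u : ℤ → S} {a i : ℤ} (h : Agree r g u a) (hi : a ≤ i) :
    Agree r (cut a g u) u i := by
  intro k h1 h2
  rcases lt_or_ge (i + k) a with hlt | hge
  · have := h (i + k - a) (by omega) (by omega)
    rw [show a + (i + k - a) = i + k by ring] at this
    rw [cut_of_lt _ _ hlt, this]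
  · exact cut_of_le _ _ hge

lemma IsMarkovShift.cut_mem (hW : IsMarkovShift W) {g u : ℤ → S} (hg : g ∈ W) (hu : u ∈ W) {a : ℤ}
    (h : Agree r g u a) : cut a g u ∈ W :=
  hW.splice g hg u hu a (by simpa using h 0 (by omega) (by omega))

lemma IsLocalOn.eq_of_agree (hΦ : IsLocalOn r W Φ) {g g' : ℤ → S} (hg : g ∈ W) (hg' : g' ∈ W)
    {i : ℤ} (h : Agree r g g' i) : Φ g i = Φ g' i :=
  hΦ g hg g' hg' i i h

lemma IsLocalOn.apply_cut_left (hΦ : IsLocalOn r W Φ) (hW : IsMarkovShift W) {g u : ℤ → S}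
    (hg : g ∈ W) (hu : u ∈ W) {a i : ℤ} (h : Agree r g u a) (hi : i ≤ a) :
    Φ (cut a g u) i = Φ g i :=
  hΦ.eq_of_agree (hW.cut_mem hg hu h) hg (agree_cut_left h hi)

lemma IsLocalOn.apply_cut_right (hΦ : IsLocalOn r W Φ) (hW : IsMarkovShift W) {g u : ℤ → S}
    (hg : g ∈ W) (hu : u ∈ W) {a i : ℤ} (h : Agree r g u a) (hi : a ≤ i) :
    Φ (cut a g u) i = Φ u i :=
  hΦ.eq_of_agree (hW.cut_mem hg hu h) hu (agree_cut_right h hi)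

lemma IsLocalOn.apply_shift (hΦ : IsLocalOn r W Φ) (hW : IsMarkovShift W) {g : ℤ → S}
    (hg : g ∈ W) (m i : ℤ) : Φ (fun j => g (m + j)) i = Φ g (m + i) :=
  hΦ _ (hW.shift_mem g hg m) g hg _ _ fun k _ _ => by rw [add_assoc]

/-- Two points of the same fiber which agree on two windows agree in between. Otherwise, the point
`h`, in which the pattern formed by the two windows occurs infinitely often, could be modified at
any one of these occurrences without changing its image, and would lie in an infinite fiber. -/
theorem eq_between_of_agree (hW : IsMarkovShift W) (hΦ : IsLocalOn r W Φ)
    (hfin : ∀ z, (fiberOn W Φ z).Finite) {h : ℤ → S} (hh : h ∈ W) (htr : ∀ g ∈ W, RVisits h g)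
    {g g' : ℤ → S} (hg : g ∈ W) (hg' : g' ∈ W) (himg : Φ g = Φ g') {a b : ℤ}
    (ha : Agree r g g' a) (hb : Agree r g g' b) {c : ℤ} (hac : a ≤ c) (hcb : c ≤ b) :
    g c = g' c := by
  by_contra hne
  have hcb' : c < b := lt_of_le_of_ne hcb (by
    rintro rfl; exact hne (by simpa using hb 0 (by omega) (by omega)))
  classical
  -- a position where `q` differs from `h`
  have hpos : ∀ q : ℤ → S, ∃ p : ℤ, q ≠ h → q p ≠ h p := by
    intro q
    by_cases hq : q = h
    · exact ⟨0, fun h' => absurd hq h'⟩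
    · obtain ⟨p, hp⟩ := Function.ne_iff.1 hq
      exact ⟨p, fun _ => hp⟩
  choose pos hpos using hpos
  obtain ⟨P, hP⟩ := ((hfin (Φ h)).image pos).bddAbove
  obtain ⟨m, hm, hmg⟩ := htr g hg (a.natAbs + b.natAbs + r + P.natAbs + 1)
  -- `u` is `g'` placed at the occurrence of `g` in `h` at position `m`
  set u : ℤ → S := fun i => g' (-m + i) with hu
  have huW : u ∈ W := hW.shift_mem g' hg' (-m)
  have hhg : ∀ i : ℤ, a - r ≤ i → i ≤ b + r → h (m + i) = g i := fun i h1 h2 =>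
    hmg i (by omega) (by omega)
  have hu' : ∀ i, u (m + i) = g' i := fun i => by simp [hu]
  have hA : Agree r h u (m + a) := by
    intro k h1 h2
    rw [add_assoc, hhg _ (by omega) (by omega), hu', ha k h1 h2]
  have hB : Agree r u h (m + b) := by
    intro k h1 h2
    rw [add_assoc, hhg _ (by omega) (by omega), hu', hb k h1 h2]
  have hv : cut (m + a) h u ∈ W := hW.cut_mem hh huW hA
  have hB' : Agree r (cut (m + a) h u) h (m + b) :=
    (agree_cut_right hA (by omega)).trans hB
  set q := cut (m + b) (cut (m + a) h u) h with hq
  have hqW : q ∈ W := hW.cut_mem hv hh hB'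
  have hqΦ : Φ q = Φ h := by
    funext i
    rcases le_total (m + b) i with h1 | h1
    · exact hΦ.apply_cut_right hW hv hh hB' h1
    · rw [hq, hΦ.apply_cut_left hW hv hh hB' h1]
      rcases le_total i (m + a) with h2 | h2
      · exact hΦ.apply_cut_left hW hh huW hA h2
      · rw [hΦ.apply_cut_right hW hh huW hA h2, hu, hΦ.apply_shift hW hg', ← himg]
        refine (hΦ h hh g hg i (-m + i) fun k h3 h4 => ?_).symm
        rw [← hhg (-m + i + k) (by omega) (by omega)]
        congr 1; ring
  have hqne : q ≠ h := by
    intro hqh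
    have h1 := congrFun hqh (m + c)
    rw [hq, cut_of_lt _ _ (by omega), cut_of_le _ _ (by omega), hu', hhg _ (by omega) (by omega)]
      at h1
    exact hne h1.symm
  have hposq : pos q ≤ P := hP ⟨q, ⟨hqW, hqΦ⟩, rfl⟩
  have hqh : ∀ p < m + a, q p = h p := fun p hp => by
    rw [hq, cut_of_lt _ _ (by omega), cut_of_lt _ _ hp]
  exact hpos q hqne (hqh _ (by omega))

/-- Along any sequence of shifts, all sequences over a finite alphabet have limits, and finitely
many of them can be approximated simultaneously. -/
lemma exists_limits [Finite S] (m : ℕ → ℤ) :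
    ∃ τ : (ℤ → S) → ℤ → S, ∀ F : Set (ℤ → S), F.Finite → ∀ N : ℕ, ∃ j : ℕ, N ≤ j ∧
      ∀ x ∈ F, ∀ i : ℤ, -(N : ℤ) ≤ i → i ≤ N → x (m j + i) = τ x i := by
  let 𝓤 : Ultrafilter ℕ := hyperfilter ℕ
  have hex : ∀ (x : ℤ → S) (i : ℤ), ∃ s, ∀ᶠ j in (𝓤 : Filter ℕ), x (m j + i) = s := by
    intro x i
    have h2 : (⋃ s ∈ (Set.univ : Set S), {s}) ∈ 𝓤.map (fun j => x (m j + i)) := by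
      rw [Set.biUnion_of_singleton]
      exact univ_mem
    obtain ⟨s, -, hs⟩ := (Ultrafilter.finite_biUnion_mem_iff Set.finite_univ).1 h2
    exact ⟨s, hs⟩
  choose τ hτ using hex
  refine ⟨τ, fun F hF N => ?_⟩
  have h1 : ∀ᶠ j in (𝓤 : Filter ℕ), ∀ x ∈ F, ∀ i ∈ Set.Icc (-(N : ℤ)) N,
      x (m j + i) = τ x i :=
    (eventually_all_finite hF).2 fun x _ =>
      (eventually_all_finite (Set.finite_Icc _ _)).2 fun i _ => hτ x i
  have h2 : ∀ᶠ j in (𝓤 : Filter ℕ), N ≤ j :=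
    (Nat.hyperfilter_le_atTop) (eventually_ge_atTop N)
  obtain ⟨j, hj1, hj2⟩ := (h2.and h1).exists
  exact ⟨j, hj1, fun x hx i h3 h4 => hj2 x hx i ⟨h3, h4⟩⟩

/-- Shifting all points of a fiber along a sequence of times at which `z` approaches `z'`, and
passing to a limit, yields a map from the fiber over `z` to the fiber over `z'`. -/
theorem exists_limit_map [Finite S] (hW : IsMarkovShift W) (hΦ : IsLocalOn r W Φ)
    (hfin : ∀ z, (fiberOn W Φ z).Finite) {z z' : ℤ → B} {m : ℕ → ℤ}
    (hm : ∀ N : ℕ, ∀ i : ℤ, -(N : ℤ) ≤ i → i ≤ N → z (m N + i) = z' i) :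
    ∃ τ : (ℤ → S) → ℤ → S, (∀ x ∈ fiberOn W Φ z, τ x ∈ fiberOn W Φ z') ∧
      ∀ N : ℕ, ∃ j : ℕ, N ≤ j ∧ ∀ x ∈ fiberOn W Φ z, ∀ i : ℤ, -(N : ℤ) ≤ i → i ≤ N →
        x (m j + i) = τ x i := by
  obtain ⟨τ, hτ⟩ := exists_limits (S := S) m
  have key := hτ _ (hfin z)
  refine ⟨τ, fun x hx => ?_, key⟩
  have hτW : τ x ∈ W := by
    refine hW.closed _ fun N => ?_
    obtain ⟨j, -, hj⟩ := key N
    exact ⟨_, hW.shift_mem x hx.1 (m j), fun i h1 h2 => hj x hx i h1 h2⟩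
  refine ⟨hτW, funext fun i => ?_⟩
  obtain ⟨j, hj1, hj⟩ := key (i.natAbs + r)
  rw [← hm j i (by omega) (by omega), ← hx.2]
  refine hΦ _ hτW _ hx.1 _ _ fun k h1 h2 => ?_
  rw [add_assoc, hj x hx _ (by omega) (by omega)]

end Codes

section Codes

variable {S B : Type*} {r : ℕ} {W : Set (ℤ → S)} {Φ : (ℤ → S) → ℤ → B}

/-- A finite-to-one sliding block code on a one-step Markov shift which has a point visiting every
other point infinitely often in both directions. -/
structure IsTransitiveCode (r : ℕ) (W : Set (ℤ → S)) (Φ : (ℤ → S) → ℤ → B) : Prop where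
  markov : IsMarkovShift W
  isLocal : IsLocalOn r W Φ
  finite : ∀ z, (fiberOn W Φ z).Finite
  exists_transitive : ∃ h ∈ W, ∀ g ∈ W, RVisits h g ∧ LVisits h g

lemma IsTransitiveCode.eq_between (hC : IsTransitiveCode r W Φ) {z : ℤ → B} {g g' : ℤ → S}
    (hg : g ∈ fiberOn W Φ z) (hg' : g' ∈ fiberOn W Φ z) {a b : ℤ}
    (ha : Agree r g g' a) (hb : Agree r g g' b) {c : ℤ} (hac : a ≤ c) (hcb : c ≤ b) :
    g c = g' c := by
  obtain ⟨h, hh, htr⟩ := hC.exists_transitive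
  exact eq_between_of_agree hC.markov hC.isLocal hC.finite hh (fun g hg => (htr g hg).1) hg.1
    hg'.1 (hg.2.trans hg'.2.symm) ha hb hac hcb

lemma IsTransitiveCode.cut_mem_fiberOn (hC : IsTransitiveCode r W Φ) {z : ℤ → B} {g u : ℤ → S}
    (hg : g ∈ fiberOn W Φ z) (hu : u ∈ fiberOn W Φ z) {a : ℤ} (h : Agree r g u a) :
    cut a g u ∈ fiberOn W Φ z := by
  refine ⟨hC.markov.cut_mem hg.1 hu.1 h, funext fun i => ?_⟩
  rcases le_total i a with h1 | h1
  · rw [hC.isLocal.apply_cut_left hC.markov hg.1 hu.1 h h1, hg.2]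
  · rw [hC.isLocal.apply_cut_right hC.markov hg.1 hu.1 h h1, hu.2]

/-- No point of a fiber passes from one of two simultaneously recurrent and nowhere agreeing points
`d`, `d'` of the fiber to the other one. If `g` did, then passing from `d` to `d'` along `g` either
immediately, or after the pair `(d, d')` has returned, would give two points of the fiber which
agree on two windows, but not in between. -/
theorem IsTransitiveCode.no_transit (hC : IsTransitiveCode r W Φ) {z : ℤ → B} {d d' g : ℤ → S}
    (hd : d ∈ fiberOn W Φ z) (hd' : d' ∈ fiberOn W Φ z) (hg : g ∈ fiberOn W Φ z) {a b : ℤ}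
    (hab : a ≤ b) (ha : Agree r g d a) (hb : Agree r g d' b)
    (hrec : ∀ N : ℕ, ∃ m : ℤ, N ≤ m ∧ ∀ i : ℤ, -(N : ℤ) ≤ i → i ≤ N →
      d (m + i) = d i ∧ d' (m + i) = d' i)
    (hsep : ∀ i, ¬ Agree r d d' i) : False := by
  obtain ⟨m, hm, hmd⟩ := hrec (a.natAbs + b.natAbs + 3 * r + 2)
  have hm1 : ∀ i : ℤ, a - r ≤ i → i ≤ b + r → d (m + i) = d i := fun i h1 h2 =>
    (hmd i (by omega) (by omega)).1
  have hm2 : ∀ i : ℤ, a - r ≤ i → i ≤ b + r → d' (m + i) = d' i := fun i h1 h2 =>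
    (hmd i (by omega) (by omega)).2
  -- the immediate passage
  have hs1 := hC.cut_mem_fiberOn hd hg ha.symm
  have hb1 : Agree r (cut a d g) d' b := (agree_cut_right ha.symm hab).trans hb
  have hp1 := hC.cut_mem_fiberOn hs1 hd' hb1
  -- the passage delayed by `m`
  set u : ℤ → S := fun i => g (-m + i) with hu
  have huW : u ∈ W := hC.markov.shift_mem g hg.1 (-m)
  have hu' : ∀ i, u (m + i) = g i := fun i => by simp [hu]
  have ha2 : Agree r d u (m + a) := by
    intro k h1 h2
    rw [add_assoc, hm1 _ (by omega) (by omega), hu', ha k h1 h2]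
  have hub : Agree r u d' (m + b) := by
    intro k h1 h2
    rw [add_assoc, hm2 _ (by omega) (by omega), hu', hb k h1 h2]
  have hs2 : cut (m + a) d u ∈ W := hC.markov.cut_mem hd.1 huW ha2
  have hb2 : Agree r (cut (m + a) d u) d' (m + b) :=
    (agree_cut_right ha2 (by omega)).trans hub
  have hp2 : cut (m + b) (cut (m + a) d u) d' ∈ fiberOn W Φ z := by
    refine ⟨hC.markov.cut_mem hs2 hd'.1 hb2, funext fun i => ?_⟩
    rcases le_total (m + b) i with h1 | h1
    · rw [hC.isLocal.apply_cut_right hC.markov hs2 hd'.1 hb2 h1, hd'.2]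
    · rw [hC.isLocal.apply_cut_left hC.markov hs2 hd'.1 hb2 h1]
      rcases le_total i (m + a) with h2 | h2
      · rw [hC.isLocal.apply_cut_left hC.markov hd.1 huW ha2 h2, hd.2]
      · rw [hC.isLocal.apply_cut_right hC.markov hd.1 huW ha2 h2, hu,
          hC.isLocal.apply_shift hC.markov hg.1, hg.2, ← hd.2]
        refine (hC.isLocal d hd.1 d hd.1 i (-m + i) fun k h3 h4 => ?_).symm
        rw [← hm1 (-m + i + k) (by omega) (by omega)]
        congr 1; ring
  refine hsep (b + r + 1) fun k h1 h2 => ?_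
  have h3 := hC.eq_between hp1 hp2 (a := a) (b := m + b) (c := b + r + 1 + k)
    (((agree_cut_left hb1 hab).trans (agree_cut_left ha.symm le_rfl)).trans
      ((agree_cut_left hb2 (by omega)).trans (agree_cut_left ha2 (by omega))).symm)
    ((agree_cut_right hb1 (by omega)).trans (agree_cut_right hb2 le_rfl).symm)
    (by omega) (by omega)
  rw [cut_of_le _ _ (by omega), cut_of_lt _ _ (by omega), cut_of_lt _ _ (by omega)] at h3
  exact h3.symm

lemma IsTransitiveCode.eq_right_of_frequently (hC : IsTransitiveCode r W Φ) {z : ℤ → B}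
    {g g' : ℤ → S} (hg : g ∈ fiberOn W Φ z) (hg' : g' ∈ fiberOn W Φ z)
    (h : ∀ N : ℕ, ∃ a : ℤ, N ≤ a ∧ Agree r g g' a) : ∃ a : ℤ, ∀ i, a ≤ i → g i = g' i := by
  obtain ⟨a, -, ha⟩ := h 0
  refine ⟨a, fun i hi => ?_⟩
  obtain ⟨b, hb, hb'⟩ := h i.natAbs
  exact hC.eq_between hg hg' ha hb' hi (by omega)

lemma IsTransitiveCode.eq_left_of_frequently (hC : IsTransitiveCode r W Φ) {z : ℤ → B}
    {g g' : ℤ → S} (hg : g ∈ fiberOn W Φ z) (hg' : g' ∈ fiberOn W Φ z)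
    (h : ∀ N : ℕ, ∃ a : ℤ, a ≤ -N ∧ Agree r g g' a) : ∃ a : ℤ, ∀ i, i ≤ a → g i = g' i := by
  obtain ⟨a, -, ha⟩ := h 0
  refine ⟨a, fun i hi => ?_⟩
  obtain ⟨b, hb, hb'⟩ := h i.natAbs
  exact hC.eq_between hg hg' hb' ha (by omega) hi

/-- Over a point `z` which is recurrent to the right, there is an idempotent self-map `e` of the
fiber which is a limit of shifts to the right. -/
theorem IsTransitiveCode.exists_idempotent [Finite S] (hC : IsTransitiveCode r W Φ) {z : ℤ → B}
    (hz : RVisits z z) :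
    ∃ e : (ℤ → S) → ℤ → S, (∀ x ∈ fiberOn W Φ z, e x ∈ fiberOn W Φ z) ∧
      (∀ x ∈ fiberOn W Φ z, e (e x) = e x) ∧
      ∀ N : ℕ, ∃ m : ℤ, N ≤ m ∧ ∀ x ∈ fiberOn W Φ z, ∀ i : ℤ, -(N : ℤ) ≤ i → i ≤ N →
        x (m + i) = e x i := by
  classical
  let F := fiberOn W Φ z
  have : Finite F := hC.finite z
  let s : Set (Function.End F) := {τ | ∀ N : ℕ, ∃ m : ℤ, N ≤ m ∧
    ∀ x : F, ∀ i : ℤ, -(N : ℤ) ≤ i → i ≤ N → x.1 (m + i) = (τ x).1 i}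
  let : TopologicalSpace (Function.End F) := ⊥
  have : DiscreteTopology (Function.End F) := ⟨rfl⟩
  have : Finite (Function.End F) := inferInstanceAs (Finite (F → F))
  have hne : s.Nonempty := by
    choose m hm hmz using hz
    obtain ⟨τ, hτ, hτ'⟩ := exists_limit_map hC.markov hC.isLocal hC.finite hmz
    refine ⟨fun x => ⟨τ x.1, hτ x.1 x.2⟩, fun N => ?_⟩
    obtain ⟨j, hj, hj'⟩ := hτ' N
    exact ⟨m j, by have := hm j; omega, fun x i h1 h2 => hj' x.1 x.2 i h1 h2⟩
  have hmul : ∀ᵉ (τ ∈ s) (τ' ∈ s), τ * τ' ∈ s := by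
    intro τ hτ τ' hτ' N
    obtain ⟨m, hm, hm'⟩ := hτ N
    obtain ⟨n, hn, hn'⟩ := hτ' (N + m.natAbs)
    refine ⟨n + m, by omega, fun x i h1 h2 => ?_⟩
    rw [add_assoc, hn' x _ (by omega) (by omega), hm' (τ' x) i h1 h2]
    rfl
  obtain ⟨e, he, hee⟩ := exists_idempotent_in_compact_subsemigroup
    (fun _ => continuous_of_discreteTopology) s hne s.toFinite.isCompact hmul
  have hex : ∀ x (hx : x ∈ F), (if h : x ∈ F then (e ⟨x, h⟩).1 else x) = (e ⟨x, hx⟩).1 :=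
    fun x hx => dif_pos hx
  refine ⟨fun x => if h : x ∈ F then (e ⟨x, h⟩).1 else x, fun x hx => ?_, fun x hx => ?_,
    fun N => ?_⟩
  · simp only [hex x hx]; exact (e ⟨x, hx⟩).2
  · simp only [hex x hx, hex _ (e ⟨x, hx⟩).2]
    exact congrArg Subtype.val (congrFun hee ⟨x, hx⟩)
  · obtain ⟨m, hm, hm'⟩ := he N
    refine ⟨m, hm, fun x hx i h1 h2 => ?_⟩
    simp only [hex x hx]
    exact hm' ⟨x, hx⟩ i h1 h2

/-- Two distinct points of the fiber over a point that is recurrent in both directions nowhere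
agree on a window. -/
theorem IsTransitiveCode.eq_of_agree [Finite S] (hC : IsTransitiveCode r W Φ) {z : ℤ → B}
    (hzr : RVisits z z) (hzl : LVisits z z) {g g' : ℤ → S}
    (hg : g ∈ fiberOn W Φ z) (hg' : g' ∈ fiberOn W Φ z) {a : ℤ} (ha : Agree r g g' a) :
    g = g' := by
  classical
  set F := fiberOn W Φ z with hF
  obtain ⟨e, heF, hee, he⟩ := hC.exists_idempotent hzr
  -- `x` and `e x` are right asymptotic
  have hxe : ∀ x ∈ F, ∃ a : ℤ, ∀ i, a ≤ i → x i = e x i := by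
    intro x hx
    refine hC.eq_right_of_frequently hx (heF x hx) fun N => ?_
    obtain ⟨m, hm, hm'⟩ := he (N + r)
    refine ⟨m, by omega, fun k h1 h2 => ?_⟩
    rw [hm' x hx k (by omega) (by omega), hm' _ (heF x hx) k (by omega) (by omega), hee x hx]
  have heq : ∀ x ∈ F, ∀ x' ∈ F, (∃ a : ℤ, ∀ i, a ≤ i → x i = x' i) → e x = e x' := by
    rintro x hx x' hx' ⟨a, ha⟩
    funext i
    obtain ⟨m, hm, hm'⟩ := he (i.natAbs + a.natAbs)
    rw [← hm' x hx i (by omega) (by omega), ← hm' x' hx' i (by omega) (by omega)]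
    obtain ⟨n, hn, hn'⟩ := he (i.natAbs + a.natAbs + m.natAbs)
    exact ha _ (by omega)
  -- points in the image of `e` which agree on a window are equal
  have hsep : ∀ x ∈ F, ∀ x' ∈ F, ∀ a, Agree r (e x) (e x') a → e x = e x' := by
    intro x hx x' hx' a ha
    rw [← hee x hx, ← hee x' hx']
    refine heq _ (heF x hx) _ (heF x' hx') (hC.eq_right_of_frequently (heF x hx) (heF x' hx')
      fun N => ?_)
    obtain ⟨m, hm, hm'⟩ := he (N + a.natAbs + r)
    refine ⟨m + a, by omega, fun k h1 h2 => ?_⟩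
    rw [add_assoc, hm' _ (heF x hx) _ (by omega) (by omega),
      hm' _ (heF x' hx') _ (by omega) (by omega), hee x hx, hee x' hx', ha k h1 h2]
  -- each point is left asymptotic to a point in the image of `e`: limits of shifts to the left
  -- show that there are at most as many left asymptotic classes as points in the image
  have hleft : ∀ x ∈ F, ∃ y ∈ F, ∃ a : ℤ, ∀ i, i ≤ a → x i = e y i := by
    choose m hm hmz using hzl
    obtain ⟨τ, hτ, hτ'⟩ := exists_limit_map hC.markov hC.isLocal hC.finite hmz
    have hτL : ∀ x ∈ F, ∀ x' ∈ F, e (τ x) = e (τ x') → ∃ a : ℤ, ∀ i, i ≤ a → x i = x' i := by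
      intro x hx x' hx' hxx'
      obtain ⟨a, ha⟩ := hxe _ (hτ x hx)
      obtain ⟨a', ha'⟩ := hxe _ (hτ x' hx')
      refine hC.eq_left_of_frequently hx hx' fun N => ?_
      obtain ⟨j, hj, hj'⟩ := hτ' (N + a.natAbs + a'.natAbs + 2 * r)
      have hmj := hm j
      refine ⟨m j + (max a a' + r), by omega, fun k h1 h2 => ?_⟩
      rw [add_assoc, hj' x hx _ (by omega) (by omega), hj' x' hx' _ (by omega) (by omega),
        ha _ (by omega), ha' _ (by omega), hxx']
    have hD : (e '' F).Finite := (hC.finite z).image e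
    have hmaps : Set.MapsTo (fun x => e (τ x)) (e '' F) (e '' F) := by
      rintro _ ⟨x, hx, rfl⟩
      exact ⟨_, hτ _ (heF x hx), rfl⟩
    have hinj : Set.InjOn (fun x => e (τ x)) (e '' F) := by
      rintro _ ⟨x, hx, rfl⟩ _ ⟨x', hx', rfl⟩ h
      obtain ⟨a, ha⟩ := hτL _ (heF x hx) _ (heF x' hx') h
      exact hsep x hx x' hx' (a - r) fun k h1 h2 => ha _ (by omega)
    have hsurj : Set.SurjOn (fun x => e (τ x)) (e '' F) (e '' F) :=
      fun y hy => by
        obtain ⟨x, hx, hxy⟩ := Set.surj_on_of_inj_on_of_ncard_le (fun x _ => e (τ x))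
          (fun x hx => hmaps hx) (fun x x' hx hx' h => hinj hx hx' h) le_rfl hD y hy
        exact ⟨x, hx, hxy.symm⟩
    intro x hx
    obtain ⟨_, ⟨y, hy, rfl⟩, hy'⟩ := hsurj ⟨τ x, hτ x hx, rfl⟩
    exact ⟨y, hy, hτL x hx _ (heF y hy) hy'.symm⟩
  -- hence the image of `e` is the whole fiber
  have hfix : ∀ x ∈ F, e x = x := by
    intro x hx
    obtain ⟨y, hy, a, ha⟩ := hleft x hx
    obtain ⟨b, hb⟩ := hxe x hx
    have hA : Agree r x (e y) (min a b - r) := fun k h1 h2 => ha _ (by omega)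
    have hB : Agree r x (e x) (max a b + r) := fun k h1 h2 => hb _ (by omega)
    have hyx : e y = e x := by
      by_contra hne
      refine hC.no_transit (heF y hy) (heF x hx) hx (by omega) hA hB (fun N => ?_)
        fun i hi => hne (hsep y hy x hx i hi)
      obtain ⟨m, hm, hm'⟩ := he N
      refine ⟨m, hm, fun i h1 h2 => ?_⟩
      rw [hm' _ (heF y hy) i h1 h2, hm' _ (heF x hx) i h1 h2, hee y hy, hee x hx]
      exact ⟨rfl, rfl⟩
    rw [hyx] at ha
    funext i
    rcases le_total i a with h1 | h1
    · exact (ha i h1).symm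
    rcases le_total b i with h2 | h2
    · exact (hb i h2).symm
    · exact (hC.eq_between hx (heF x hx) (a := a - r) (b := b + r)
        (fun k _ _ => ha _ (by omega)) (fun k _ _ => hb _ (by omega)) (by omega) (by omega)).symm
  rw [← hfix g hg, ← hfix g' hg'] at ha ⊢
  exact hsep g hg g' hg' a ha

/-- Limit maps between fibers over recurrent points are injective, since distinct points of such a
fiber nowhere agree on a window. -/
theorem IsTransitiveCode.limit_injOn [Finite S] (hC : IsTransitiveCode r W Φ) {z : ℤ → B}
    (hzr : RVisits z z) (hzl : LVisits z z) {m : ℕ → ℤ} {τ : (ℤ → S) → ℤ → S}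
    (hτ : ∀ N : ℕ, ∃ j : ℕ, N ≤ j ∧ ∀ x ∈ fiberOn W Φ z, ∀ i : ℤ, -(N : ℤ) ≤ i → i ≤ N →
        x (m j + i) = τ x i) : Set.InjOn τ (fiberOn W Φ z) := by
  intro x hx x' hx' hxx'
  obtain ⟨j, -, hj⟩ := hτ r
  exact hC.eq_of_agree hzr hzl hx hx' (a := m j) fun k h1 h2 => by
    rw [hj x hx k h1 h2, hj x' hx' k h1 h2, hxx']

theorem IsTransitiveCode.ncard_fiberOn_le [Finite S] (hC : IsTransitiveCode r W Φ) {z z' : ℤ → B}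
    (hzr : RVisits z z) (hzl : LVisits z z) (hzz' : RVisits z z') :
    (fiberOn W Φ z).ncard ≤ (fiberOn W Φ z').ncard := by
  choose m hm hmz using hzz'
  obtain ⟨τ, hτ, hτ'⟩ := exists_limit_map hC.markov hC.isLocal hC.finite hmz
  exact Set.ncard_le_ncard_of_injOn τ hτ (hC.limit_injOn hzr hzl hτ') (hC.finite z')

lemma IsLocalOn.rVisits (hΦ : IsLocalOn r W Φ) {g g' : ℤ → S} (hg : g ∈ W) (hg' : g' ∈ W)
    (h : RVisits g g') : RVisits (Φ g) (Φ g') := by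
  intro N
  obtain ⟨m, hm, hm'⟩ := h (N + r)
  refine ⟨m, by omega, fun i h1 h2 => hΦ _ hg _ hg' _ _ fun k h3 h4 => ?_⟩
  rw [add_assoc, hm' _ (by omega) (by omega)]

lemma IsLocalOn.lVisits (hΦ : IsLocalOn r W Φ) {g g' : ℤ → S} (hg : g ∈ W) (hg' : g' ∈ W)
    (h : LVisits g g') : LVisits (Φ g) (Φ g') := by
  intro N
  obtain ⟨m, hm, hm'⟩ := h (N + r)
  refine ⟨m, by omega, fun i h1 h2 => hΦ _ hg _ hg' _ _ fun k h3 h4 => ?_⟩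
  rw [add_assoc, hm' _ (by omega) (by omega)]

lemma sees_of_limit {F : Set (ℤ → S)} {m : ℕ → ℤ} {τ : (ℤ → S) → ℤ → S}
    (hτ : ∀ N : ℕ, ∃ j : ℕ, N ≤ j ∧ ∀ x ∈ F, ∀ i : ℤ, -(N : ℤ) ≤ i → i ≤ N →
        x (m j + i) = τ x i) {x u : ℤ → S} (hx : x ∈ F) (h : Sees (τ x) u) (N M : ℕ) :
    ∃ j : ℕ, ∃ n : ℤ, M + n.natAbs ≤ j ∧ ∀ i : ℤ, -(N : ℤ) ≤ i → i ≤ N →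
      x (m j + n + i) = u i := by
  obtain ⟨n, hn⟩ := h N
  obtain ⟨j, hj, hj'⟩ := hτ (M + N + n.natAbs)
  refine ⟨j, n, by omega, fun i h1 h2 => ?_⟩
  rw [add_assoc, hj' x hx _ (by omega) (by omega), hn i h1 h2]

/-- All points in the fiber over a point `z` visiting every point of the image see every point of
`W`. Fibers over such points are identified by limit maps, which preserve the points that fail to
see everything. If `g` were such a point over `z`, then a limit map from the fiber over the image
of a transitive point `h`, along times at which `h` approaches `g`, would produce one failing point
more in the fiber over `z` than there are in the fiber over `Φ h`. -/
theorem IsTransitiveCode.sees [Finite S] (hC : IsTransitiveCode r W Φ) {z : ℤ → B}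
    (hz : ∀ u ∈ W, RVisits z (Φ u) ∧ LVisits z (Φ u)) {g u : ℤ → S}
    (hg : g ∈ fiberOn W Φ z) (hu : u ∈ W) : Sees g u := by
  by_contra hgu
  obtain ⟨h, hh, htr⟩ := hC.exists_transitive
  let bad : (ℤ → B) → Set (ℤ → S) := fun z => {x | x ∈ fiberOn W Φ z ∧ ¬ ∀ u ∈ W, Sees x u}
  have hbadfin : ∀ z, (bad z).Finite := fun z => (hC.finite z).subset fun x hx => hx.1
  have hbad : ∀ (z z' : ℤ → B) (m : ℕ → ℤ) (τ : (ℤ → S) → ℤ → S),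
      (∀ x ∈ fiberOn W Φ z, τ x ∈ fiberOn W Φ z') →
      (∀ N : ℕ, ∃ j : ℕ, N ≤ j ∧ ∀ x ∈ fiberOn W Φ z, ∀ i : ℤ, -(N : ℤ) ≤ i → i ≤ N →
        x (m j + i) = τ x i) → ∀ x ∈ bad z, τ x ∈ bad z' := by
    intro z z' m τ hτ hτ' x hx
    refine ⟨hτ x hx.1, fun hall => hx.2 fun u hu N => ?_⟩
    obtain ⟨j, n, -, hjn⟩ := sees_of_limit hτ' hx.1 (hall u hu) N 0
    exact ⟨_, hjn⟩
  have hrz : RVisits z z := by have := (hz g hg.1).1; rwa [hg.2] at this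
  have hlz : LVisits z z := by have := (hz g hg.1).2; rwa [hg.2] at this
  have h1 : (bad z).ncard ≤ (bad (Φ h)).ncard := by
    choose m hm hmz using (hz h hh).1
    obtain ⟨τ, hτ, hτ'⟩ := exists_limit_map hC.markov hC.isLocal hC.finite hmz
    exact Set.ncard_le_ncard_of_injOn τ (hbad _ _ _ _ hτ hτ')
      ((hC.limit_injOn hrz hlz hτ').mono fun x hx => hx.1) (hbadfin _)
  have h2 : (bad (Φ h)).ncard + 1 ≤ (bad z).ncard := by
    choose m hm hmz using (htr g hg.1).1
    have hmz' : ∀ N : ℕ, ∀ i : ℤ, -(N : ℤ) ≤ i → i ≤ N → Φ h (m (N + r) + i) = z i := by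
      intro N i h1 h2
      rw [← hg.2]
      refine hC.isLocal _ hh _ hg.1 _ _ fun k h3 h4 => ?_
      rw [add_assoc, hmz (N + r) _ (by omega) (by omega)]
    obtain ⟨τ, hτ, hτ'⟩ := exists_limit_map hC.markov hC.isLocal hC.finite hmz'
    have hhF : h ∈ fiberOn W Φ (Φ h) := ⟨hh, rfl⟩
    have hτh : τ h = g := by
      funext i
      obtain ⟨j, hj, hj'⟩ := hτ' i.natAbs
      rw [← hj' h hhF i (by omega) (by omega), hmz (j + r) i (by omega) (by omega)]
    have hnot : h ∉ bad (Φ h) := fun hb => hb.2 fun u hu N => by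
      obtain ⟨m, -, hm⟩ := (htr u hu).1 N
      exact ⟨m, hm⟩
    rw [← Set.ncard_insert_of_notMem hnot (hbadfin _)]
    refine Set.ncard_le_ncard_of_injOn τ ?_ ((hC.limit_injOn
      (hC.isLocal.rVisits hh hh (htr h hh).1) (hC.isLocal.lVisits hh hh (htr h hh).2) hτ').mono
      (Set.insert_subset hhF fun x hx => hx.1)) (hbadfin _)
    rintro x (rfl | hx)
    · rw [hτh]; exact ⟨hg, fun hall => hgu (hall u hu)⟩
    · exact hbad _ _ _ _ hτ hτ' x hx
  omega

/-- All points in the fiber over a point visiting every point of the image infinitely often in both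
directions visit every point of `W` infinitely often in both directions. -/
theorem IsTransitiveCode.visits [Finite S] (hC : IsTransitiveCode r W Φ) {z : ℤ → B}
    (hz : ∀ u ∈ W, RVisits z (Φ u) ∧ LVisits z (Φ u)) {g u : ℤ → S}
    (hg : g ∈ fiberOn W Φ z) (hu : u ∈ W) : RVisits g u ∧ LVisits g u := by
  have hzz := hz g hg.1
  rw [hg.2] at hzz
  constructor
  · choose m hm hmz using hzz.1
    obtain ⟨τ, hτ, hτ'⟩ := exists_limit_map hC.markov hC.isLocal hC.finite hmz
    intro N
    obtain ⟨j, n, hj, hjn⟩ := sees_of_limit hτ' hg (hC.sees hz (hτ g hg) hu) N N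
    exact ⟨m j + n, by have := hm j; omega, hjn⟩
  · choose m hm hmz using hzz.2
    obtain ⟨τ, hτ, hτ'⟩ := exists_limit_map hC.markov hC.isLocal hC.finite hmz
    intro N
    obtain ⟨j, n, hj, hjn⟩ := sees_of_limit hτ' hg (hC.sees hz (hτ g hg) hu) N N
    exact ⟨m j + n, by have := hm j; omega, hjn⟩

end Codes

/-! ### Transitive points of Markov shifts -/

section Transitive

variable {S : Type*}

lemma exists_window_subset [TopologicalSpace S] {U : Set (ℤ → S)} (hU : IsOpen U)
    {g : ℤ → S} (hg : g ∈ U) :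
    ∃ N : ℕ, ∀ g' : ℤ → S, (∀ i : ℤ, -(N : ℤ) ≤ i → i ≤ N → g' i = g i) → g' ∈ U := by
  obtain ⟨I, u, hu, hI⟩ := isOpen_pi_iff.1 hU g hg
  refine ⟨I.sup Int.natAbs, fun g' hg' => hI fun i hi => ?_⟩
  have : i.natAbs ≤ I.sup Int.natAbs := Finset.le_sup (f := Int.natAbs) hi
  rw [hg' i (by omega) (by omega)]
  exact (hu i hi).2

lemma isOpen_window [TopologicalSpace S] [DiscreteTopology S] (N : ℕ) (m : ℤ) (g : ℤ → S) :
    IsOpen {h : ℤ → S | ∀ i ∈ Set.Icc (-(N : ℤ)) N, h (m + i) = g i} := by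
  have : {h : ℤ → S | ∀ i ∈ Set.Icc (-(N : ℤ)) N, h (m + i) = g i} =
      ⋂ i ∈ Set.Icc (-(N : ℤ)) N, (fun h : ℤ → S => h (m + i)) ⁻¹' {g i} := by ext; simp
  rw [this]
  exact (Set.finite_Icc _ _).isOpen_biInter fun i _ =>
    (isOpen_discrete {g i}).preimage (continuous_apply (m + i))

lemma mem_of_isClosed_of_agree [TopologicalSpace S] {X : Set (ℤ → S)} (hX : IsClosed X)
    {g : ℤ → S} (h : ∀ N : ℕ, ∃ g' ∈ X, ∀ i : ℤ, -(N : ℤ) ≤ i → i ≤ N → g' i = g i) : g ∈ X := by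
  rw [← hX.closure_eq, mem_closure_iff]
  intro U hU hg
  obtain ⟨N, hN⟩ := exists_window_subset hU hg
  obtain ⟨g', hg', hN'⟩ := h N
  exact ⟨g', hN g' hN', hg'⟩

lemma IsMarkovShift.isClosed [TopologicalSpace S] [DiscreteTopology S] {W : Set (ℤ → S)}
    (hW : IsMarkovShift W) : IsClosed W := by
  refine isClosed_of_closure_subset fun g hg => hW.closed g fun N => ?_
  obtain ⟨g', hg', hg''⟩ := mem_closure_iff.1 hg _ (isOpen_window N 0 g) fun i _ => by simp
  exact ⟨g', hg'', fun i h1 h2 => by simpa using hg' i ⟨h1, h2⟩⟩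

/-- By the Baire category theorem, a Markov shift in which any point can be continued by any other
point has a point visiting all points infinitely often in both directions. -/
theorem IsMarkovShift.exists_transitive [Finite S] {W : Set (ℤ → S)} (hW : IsMarkovShift W)
    (hne : W.Nonempty)
    (hglue : ∀ g ∈ W, ∀ u ∈ W, ∀ a b M : ℤ, ∃ h ∈ W, ∃ c : ℤ, M ≤ c ∧
      (∀ i, i ≤ a → h i = g i) ∧ ∀ i, b ≤ i → h (c + i) = u i) :
    ∃ h ∈ W, ∀ g ∈ W, RVisits h g ∧ LVisits h g := by
  let : TopologicalSpace S := ⊥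
  have : DiscreteTopology S := ⟨rfl⟩
  have : CompactSpace W := isCompact_iff_compactSpace.1 hW.isClosed.isCompact
  have : Nonempty W := hne.to_subtype
  let u : ℕ → W := TopologicalSpace.denseSeq W
  let R : ℕ × ℕ → Set W := fun p => ⋃ m ∈ Set.Ici (p.2 : ℤ),
    {h | ∀ i ∈ Set.Icc (-(p.2 : ℤ)) p.2, h.1 (m + i) = (u p.1).1 i}
  let L : ℕ × ℕ → Set W := fun p => ⋃ m ∈ Set.Iic (-p.2 : ℤ),
    {h | ∀ i ∈ Set.Icc (-(p.2 : ℤ)) p.2, h.1 (m + i) = (u p.1).1 i}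
  have hRo : ∀ p, IsOpen (R p) := fun p => isOpen_biUnion fun m _ =>
    (isOpen_window p.2 m (u p.1).1).preimage continuous_subtype_val
  have hLo : ∀ p, IsOpen (L p) := fun p => isOpen_biUnion fun m _ =>
    (isOpen_window p.2 m (u p.1).1).preimage continuous_subtype_val
  have hdense : ∀ V : Set W, (∀ g : W, ∀ K : ℕ, ∃ h ∈ V, ∀ i : ℤ, -(K : ℤ) ≤ i → i ≤ K →
      h.1 i = g.1 i) → Dense V := by
    intro V hV g
    rw [mem_closure_iff]
    rintro O ⟨O', hO', rfl⟩ hgO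
    obtain ⟨K, hK⟩ := exists_window_subset hO' hgO
    obtain ⟨h, hhV, hh⟩ := hV g K
    exact ⟨h, hK h.1 hh, hhV⟩
  have hRd : ∀ p, Dense (R p) := fun p => hdense _ fun g K => by
    obtain ⟨h, hh, c, hc, h1, h2⟩ := hglue g g.2 (u p.1) (u p.1).2 K (-p.2) p.2
    exact ⟨⟨h, hh⟩, Set.mem_biUnion (show c ∈ Set.Ici (p.2 : ℤ) from hc) fun i hi => h2 i hi.1,
      fun i _ hi => h1 i hi⟩
  have hLd : ∀ p, Dense (L p) := fun p => hdense _ fun g K => by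
    obtain ⟨h, hh, c, hc, h1, h2⟩ := hglue (u p.1) (u p.1).2 g g.2 p.2 (-K) p.2
    refine ⟨⟨_, hW.shift_mem h hh c⟩, Set.mem_biUnion (x := -c) (Set.mem_Iic.2 (by omega))
      fun i hi => ?_, fun i hi _ => h2 i hi⟩
    rw [← h1 i hi.2]
    simp
  obtain ⟨h, hh⟩ := (dense_iInter_of_isOpen (fun p => (hRo p).inter (hLo p))
    fun p => (hRd p).inter_of_isOpen_left (hLd p) (hRo p)).nonempty
  rw [Set.mem_iInter] at hh
  refine ⟨h.1, h.2, fun g hg => ?_⟩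
  have happrox : ∀ N : ℕ, ∃ n, ∀ i ∈ Set.Icc (-(N : ℤ)) N, (u n).1 i = g i := by
    intro N
    obtain ⟨n, hn⟩ := (TopologicalSpace.denseRange_denseSeq W).exists_mem_open
      ((isOpen_window N 0 g).preimage continuous_subtype_val) ⟨⟨g, hg⟩, fun i _ => by simp⟩
    exact ⟨n, fun i hi => by simpa using hn i hi⟩
  constructor
  · intro N
    obtain ⟨n, hn⟩ := happrox N
    obtain ⟨m, hm, hm'⟩ := Set.mem_iUnion₂.1 (hh (n, N)).1
    exact ⟨m, hm, fun i h1 h2 => (hm' i ⟨h1, h2⟩).trans (hn i ⟨h1, h2⟩)⟩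
  · intro N
    obtain ⟨n, hn⟩ := happrox N
    obtain ⟨m, hm, hm'⟩ := Set.mem_iUnion₂.1 (hh (n, N)).2
    exact ⟨m, hm, fun i h1 h2 => (hm' i ⟨h1, h2⟩).trans (hn i ⟨h1, h2⟩)⟩

/-- The sequences all of whose transitions occur arbitrarily far to the right in `x`. -/
def recurrentShift (x : ℤ → S) : Set (ℤ → S) :=
  {g | ∀ i N : ℤ, ∃ t : ℤ, N ≤ t ∧ x t = g i ∧ x (t + 1) = g (i + 1)}

lemma isMarkovShift_recurrentShift (x : ℤ → S) : IsMarkovShift (recurrentShift x) where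
  shift_mem g hg m i N := by
    obtain ⟨t, ht, h1, h2⟩ := hg (m + i) N
    exact ⟨t, ht, h1, by rw [h2, add_assoc]⟩
  closed g hg i N := by
    obtain ⟨g', hg', h⟩ := hg (i.natAbs + 1)
    obtain ⟨t, ht, h1, h2⟩ := hg' i N
    exact ⟨t, ht, by rw [h1, h _ (by omega) (by omega)], by rw [h2, h _ (by omega) (by omega)]⟩
  splice g hg g' hg' a ha i N := by
    rcases lt_trichotomy (i + 1) a with h | h | h
    · simpa [show i < a by omega, h] using hg i N
    · subst h
      simpa [← ha] using hg i N
    · simpa [show ¬ i < a by omega, show ¬ i + 1 < a by omega] using hg' i N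

/-- Beyond some position, all transitions in a sequence over a finite alphabet occur arbitrarily
far to the right. -/
lemma exists_forall_recurrent [Finite S] (x : ℤ → S) :
    ∃ K : ℤ, ∀ s, K ≤ s → ∀ N : ℤ, ∃ t, N ≤ t ∧ x t = x s ∧ x (t + 1) = x (s + 1) := by
  have hex : ∀ p : S × S, ∃ K : ℤ, (∃ s, K ≤ s ∧ (x s, x (s + 1)) = p) →
      ∀ N : ℤ, ∃ t, N ≤ t ∧ (x t, x (t + 1)) = p := by
    intro p
    by_contra! hcon
    obtain ⟨-, N, hN⟩ := hcon 0
    obtain ⟨⟨s, hs, hs'⟩, -⟩ := hcon N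
    exact hN s hs hs'
  choose K hK using hex
  obtain ⟨M, hM⟩ := (Set.finite_range K).bddAbove
  refine ⟨M, fun s hs N => ?_⟩
  obtain ⟨t, ht, ht'⟩ := hK (x s, x (s + 1)) ⟨s, (hM ⟨_, rfl⟩).trans hs, rfl⟩ N
  exact ⟨t, ht, congrArg Prod.fst ht', congrArg Prod.snd ht'⟩

/-- A path from `g a` to `u b` within `x`, far enough to the right, connects the left half of `g`
to the right half of `u`. -/
lemma recurrentShift_glue [Finite S] (x : ℤ → S) {g u : ℤ → S} (hg : g ∈ recurrentShift x)
    (hu : u ∈ recurrentShift x) (a b M : ℤ) :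
    ∃ h ∈ recurrentShift x, ∃ c : ℤ, M ≤ c ∧ (∀ i, i ≤ a → h i = g i) ∧
      ∀ i, b ≤ i → h (c + i) = u i := by
  obtain ⟨K, hK⟩ := exists_forall_recurrent x
  obtain ⟨s, hs, hsa, -⟩ := hg a K
  obtain ⟨t, ht, htb, -⟩ := hu b (s + max 0 (M + b - a) + 1)
  -- `x` on `[s, t]` is put on `[a, a + t - s]`
  have key : ∀ i, a ≤ i → i ≤ a + (t - s) →
      cut (a + (t - s)) (cut a g (fun i => x (s - a + i))) (fun i => u (b - a - (t - s) + i)) i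
        = x (s - a + i) := by
    intro i h1 h2
    rcases h2.lt_or_eq with h2 | rfl
    · rw [cut_of_lt _ _ h2, cut_of_le _ _ h1]
    · rw [cut_of_le _ _ le_rfl, show s - a + (a + (t - s)) = t by ring, htb]
      congr 1; ring
  have keyl : ∀ i, i ≤ a →
      cut (a + (t - s)) (cut a g (fun i => x (s - a + i))) (fun i => u (b - a - (t - s) + i)) i
        = g i := by
    intro i h1
    rcases h1.lt_or_eq with h1 | rfl
    · rw [cut_of_lt _ _ (by omega), cut_of_lt _ _ h1]
    · rw [key _ le_rfl (by omega), ← hsa]; congr 1; ring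
  have keyr : ∀ i, a + (t - s) ≤ i →
      cut (a + (t - s)) (cut a g (fun i => x (s - a + i))) (fun i => u (b - a - (t - s) + i)) i
        = u (b - a - (t - s) + i) := fun i h1 => cut_of_le _ _ h1
  refine ⟨_, fun i N => ?_, a + (t - s) - b, by omega, keyl, fun i hi => ?_⟩
  · rcases lt_or_ge i a with h1 | h1
    · rw [keyl i (by omega), keyl (i + 1) (by omega)]
      exact hg i N
    rcases lt_or_ge i (a + (t - s)) with h2 | h2
    · rw [key i (by omega) (by omega), key (i + 1) (by omega) (by omega), ← add_assoc]
      exact hK _ (by omega) N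
    · rw [keyr i (by omega), keyr (i + 1) (by omega), ← add_assoc]
      exact hu _ N
  · rw [keyr _ (by omega)]; congr 1; ring

/-- Limits of shifts of `x` to the right lie in `recurrentShift x`. -/
lemma exists_limit_mem_recurrentShift [Finite S] (x : ℤ → S) {m : ℕ → ℤ}
    (hm : ∀ N : ℕ, (N : ℤ) ≤ m N) :
    ∃ g ∈ recurrentShift x, ∀ N : ℕ, ∃ j : ℕ, N ≤ j ∧ ∀ i : ℤ, -(N : ℤ) ≤ i → i ≤ N →
      x (m j + i) = g i := by
  obtain ⟨τ, hτ⟩ := exists_limits (S := S) m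
  have key : ∀ N : ℕ, ∃ j : ℕ, N ≤ j ∧ ∀ i : ℤ, -(N : ℤ) ≤ i → i ≤ N → x (m j + i) = τ x i :=
    fun N => (hτ {x} (Set.finite_singleton x) N).imp fun j hj => ⟨hj.1, hj.2 x rfl⟩
  refine ⟨τ x, fun i N => ?_, key⟩
  obtain ⟨j, hj, hj'⟩ := key (i.natAbs + 1 + N.natAbs)
  have := hm j
  refine ⟨m j + i, by omega, hj' i (by omega) (by omega), ?_⟩
  rw [add_assoc, hj' _ (by omega) (by omega)]

end Transitive

/-! ### A deterministic irreducible cover of a sofic shift -/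

section Cover

variable {A B : Type*}

/-- The right half `y` of a sequence, starting at `0`, attached to the left half of `x` at `i`. -/
def attach (x : ℤ → A) (i : ℤ) (y : ℤ → A) : ℤ → A := fun k => if k < i then x k else y (k - i)

/-- The follower set of the left half of `x` at `i`. Membership of `y` depends only on the values of
`y` at nonnegative positions. -/
def followers (X : Set (ℤ → A)) (x : ℤ → A) (i : ℤ) : Set (ℤ → A) := {y | attach x i y ∈ X}

/-- The follower set after reading the symbol `a`, where `F` is the follower set before it. The
value `a` at negative positions is a filler. -/
def afterSymbol (a : A) (F : Set (ℤ → A)) : Set (ℤ → A) :=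
  {y | (fun k => if k ≤ 0 then a else y (k - 1)) ∈ F}

lemma followers_succ (X : Set (ℤ → A)) (x : ℤ → A) (i : ℤ) :
    followers X x (i + 1) = afterSymbol (x i) (followers X x i) := by
  ext y
  have : attach x (i + 1) y = attach x i (fun k => if k ≤ 0 then x i else y (k - 1)) := by
    funext k
    rcases lt_trichotomy k i with h | h | h
    · simp [attach, h, show k < i + 1 by omega]
    · simp [attach, h]
    · simp only [attach, show ¬ k < i + 1 by omega, show ¬ k < i by omega, if_false,
        show ¬ k - i ≤ 0 by omega]
      congr 1; ring
  simp only [followers, afterSymbol, Set.mem_ofPred_eq, this]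

lemma finite_range_followers [TopologicalSpace A] {X : Subshift A ℤ} (hX : IsSofic X)
    (x : ℤ → A) : (Set.range (followers X.carrier x)).Finite := by
  obtain ⟨n, E, hE⟩ := hX
  -- a follower set is determined by the set of end points of left-infinite paths
  let G : Set (Fin n) → Set (ℤ → A) := fun Q =>
    {y | ∃ u : ℤ → Fin n, u 0 ∈ Q ∧ ∀ k, 0 ≤ k → E (u k) (y k) (u (k + 1))}
  refine (Set.finite_range G).subset ?_
  rintro _ ⟨i, rfl⟩
  refine ⟨{q | ∃ v : ℤ → Fin n, v i = q ∧ ∀ k, k < i → E (v k) (x k) (v (k + 1))}, ?_⟩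
  ext y
  simp only [followers, hE, Set.mem_ofPred_eq, G]
  constructor
  · rintro ⟨u, ⟨v, hv, hv'⟩, hu⟩
    refine ⟨fun k => if k < i then v k else u (k - i), fun k => ?_⟩
    rcases lt_trichotomy (k + 1) i with h | h | h
    · simpa [attach, show k < i by omega, h] using hv' k (by omega)
    · have := hv' k (by omega)
      rw [h, hv] at this
      simpa [attach, show k < i by omega, h] using this
    · have := hu (k - i) (by omega)
      rw [show k - i + 1 = k + 1 - i by ring] at this
      simpa [attach, show ¬ k < i by omega, show ¬ k + 1 < i by omega] using this
  · rintro ⟨v, hv⟩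
    refine ⟨fun k => v (k + i), ⟨v, by simp, fun k hk => ?_⟩, fun k hk => ?_⟩
    · simpa [attach, hk] using hv k
    · have := hv (k + i)
      rw [show k + i + 1 = k + 1 + i by ring] at this
      simpa [attach, show ¬ k < 0 by omega] using this

/-- If the second components of the points of a Markov shift `W` over a finite alphabet `Q × A` are
labels, and each symbol determines the first component of the next one, then finitely many points
have the same label sequence: two such points differing at some position differ in their first
component at all earlier positions. -/
lemma finite_fiber_of_deterministic {Q : Type*} [Finite Q] {W : Set (ℤ → Q × A)}
    {δ : A → Q → Q} (hW : ∀ g ∈ W, ∀ i, (g (i + 1)).1 = δ (g i).2 (g i).1) (x : ℤ → A) :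
    {g | g ∈ W ∧ (fun i => (g i).2) = x}.Finite := by
  by_contra hinf
  obtain ⟨T, hT, hTf, hTc⟩ := Set.Infinite.exists_subset_ncard_eq hinf (Nat.card Q + 1)
  classical
  have hpos : ∀ p : (ℤ → Q × A) × (ℤ → Q × A), ∃ i, p.1 ≠ p.2 → p.1 i ≠ p.2 i := by
    intro p
    by_cases hp : p.1 = p.2
    · exact ⟨0, fun h => absurd hp h⟩
    · obtain ⟨i, hi⟩ := Function.ne_iff.1 hp
      exact ⟨i, fun _ => hi⟩
  choose pos hpos using hpos
  obtain ⟨a, ha⟩ := ((hTf.prod hTf).image pos).bddBelow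
  have hninj : ¬ Set.InjOn (fun g : ℤ → Q × A => (g a).1) T := by
    intro hinj
    have := Set.ncard_le_ncard_of_injOn (t := Set.univ) _ (fun _ _ => Set.mem_univ _) hinj
      Set.finite_univ
    rw [hTc, Set.ncard_univ] at this
    omega
  simp only [Set.InjOn, not_forall] at hninj
  obtain ⟨g, hg, g', hg', hgg', hne⟩ := hninj
  have hlab : ∀ i, (g i).2 = (g' i).2 := fun i =>
    (congrFun (hT hg).2 i).trans (congrFun (hT hg').2 i).symm
  have hstep : ∀ n : ℕ, (g (a + n)).1 = (g' (a + n)).1 := by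
    intro n
    induction n with
    | zero => simpa using hgg'
    | succ n ih =>
      push_cast
      rw [← add_assoc, hW g (hT hg).1, hW g' (hT hg').1, ih, hlab]
  have hle : a ≤ pos (g, g') := ha ⟨(g, g'), ⟨hg, hg'⟩, rfl⟩
  apply hpos (g, g') hne
  have := hstep (pos (g, g') - a).toNat
  rw [Int.toNat_of_nonneg (by omega), add_sub_cancel] at this
  exact Prod.ext this (hlab _)

/-- A sofic shift with a point `x` visiting all points infinitely often to the right is the image
of a transitive one-step Markov shift under a finite-to-one one-block code. The Markov shift
consists of the sequences whose transitions recur in the sequence of symbols of `x`, decorated with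
the follower sets of the left halves of `x`. -/
theorem exists_transitive_cover.{u} {A : Type u} [Finite A] [TopologicalSpace A] {X : Subshift A ℤ}
    (hX : IsSofic X) {x : ℤ → A} (hx : x ∈ X.carrier) (hvis : ∀ x' ∈ X.carrier, RVisits x x') :
    ∃ (S : Type u) (_ : Finite S) (W : Set (ℤ → S)) (L : (ℤ → S) → ℤ → A),
      IsTransitiveCode 0 W L ∧ L '' W = X.carrier := by
  classical
  let Q := Set.range (followers X.carrier x)
  have : Finite Q := (finite_range_followers hX x).to_subtype
  let ξ : ℤ → Q × A := fun i => (⟨followers X.carrier x i, i, rfl⟩, x i)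
  let L : (ℤ → Q × A) → ℤ → A := fun g i => (g i).2
  have hdet : ∀ g ∈ recurrentShift ξ, ∀ i,
      ((g (i + 1)).1 : Set (ℤ → A)) = afterSymbol (g i).2 (g i).1 := by
    intro g hg i
    obtain ⟨t, -, h1, h2⟩ := hg i 0
    rw [← h1, ← h2]
    exact followers_succ X.carrier x t
  have hlabel : ∀ g ∈ recurrentShift ξ, L g ∈ X.carrier := by
    intro g hg
    -- reading the labels of `g` on `[a, a + n)` leads from the state at `a` to that at `a + n`
    have hread : ∀ (a : ℤ) (n : ℕ) (y : ℤ → A), y ∈ ((g (a + n)).1 : Set (ℤ → A)) →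
        (fun k : ℤ => if k < n then (g (a + k)).2 else y (k - n)) ∈
          ((g a).1 : Set (ℤ → A)) := by
      intro a n
      induction n with
      | zero =>
        intro y hy
        obtain ⟨t, -, ht, -⟩ := hg a 0
        rw [Nat.cast_zero, add_zero, ← ht] at hy
        rw [← ht]
        have : attach x t (fun k : ℤ => if k < (0 : ℕ) then (g (a + k)).2 else y (k - (0 : ℕ))) =
            attach x t y := by
          funext k
          by_cases hk : k < t
          · simp [attach, hk]
          · simp [attach, hk, show ¬ k - t < 0 by omega]
        change attach x t _ ∈ X.carrier
        rw [this]
        exact hy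
      | succ n ih =>
        intro y hy
        push_cast at hy
        rw [← add_assoc, hdet g hg] at hy
        refine Set.mem_of_eq_of_mem ?_ (ih _ hy)
        funext k
        rcases lt_trichotomy k n with h | h | h
        · simp [h, show k < (n : ℤ) + 1 by omega]
        · simp [h]
        · simp only [show ¬ k < ((n + 1 : ℕ) : ℤ) by omega, show ¬ k < (n : ℤ) by omega,
            show ¬ k - (n : ℤ) ≤ 0 by omega, if_false]
          congr 1; push_cast; ring
    refine mem_of_isClosed_of_agree X.isClosed fun N => ?_
    obtain ⟨t, -, ht, -⟩ := hg (-N) 0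
    obtain ⟨s, -, hs, -⟩ := hg (-N + (2 * N + 1 : ℕ)) 0
    have hend : (fun k => x (s + k)) ∈ ((g (-N + (2 * N + 1 : ℕ))).1 : Set (ℤ → A)) := by
      rw [← hs]
      change attach x s _ ∈ X.carrier
      refine Set.mem_of_eq_of_mem ?_ hx
      funext k
      simp [attach]
    have hstart := hread _ _ _ hend
    rw [← ht] at hstart
    refine ⟨_, X.mapsTo (t + N) hstart, fun i h1 h2 => ?_⟩
    have h3 : ¬ t + N + i < t := by omega
    have h4 : t + N + i - t < ((2 * N + 1 : ℕ) : ℤ) := by omega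
    simp only [SymbolicDynamics.FullShift.shift_apply, attach, h3, h4, if_true, if_false, L]
    congr 2; ring
  have hsurj : ∀ x' ∈ X.carrier, ∃ g ∈ recurrentShift ξ, L g = x' := by
    intro x' hx'
    choose m hm hmx using hvis x' hx'
    obtain ⟨g, hg, hg'⟩ := exists_limit_mem_recurrentShift ξ hm
    refine ⟨g, hg, funext fun i => ?_⟩
    obtain ⟨j, hj, hj'⟩ := hg' i.natAbs
    rw [← hmx j i (by omega) (by omega)]
    exact congrArg Prod.snd (hj' i (by omega) (by omega)).symm
  refine ⟨Q × A, inferInstance, recurrentShift ξ, L, ⟨isMarkovShift_recurrentShift ξ, ?_, ?_, ?_⟩,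
    ?_⟩
  · intro g _ g' _ i j h
    have := h 0 (by simp) (by simp)
    simp only [add_zero] at this
    exact congrArg Prod.snd this
  · intro z
    let δ : A → Q → Q := fun a F => if h : afterSymbol a F.1 ∈ Q then ⟨_, h⟩ else F
    have hδ : ∀ g ∈ recurrentShift ξ, ∀ i, (g (i + 1)).1 = δ (g i).2 (g i).1 := by
      intro g hg i
      have h1 := hdet g hg i
      have h2 : afterSymbol (g i).2 (g i).1 ∈ Q := h1 ▸ (g (i + 1)).1.2
      simp only [δ, h2, dif_pos]
      exact Subtype.ext h1
    exact finite_fiber_of_deterministic (δ := δ) hδ z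
  · obtain ⟨g, hg, -⟩ := hsurj x hx
    exact (isMarkovShift_recurrentShift ξ).exists_transitive ⟨g, hg⟩
      fun g hg u hu a b M => recurrentShift_glue ξ hg hu a b M
  · ext x'
    exact ⟨fun ⟨g, hg, h⟩ => h ▸ hlabel g hg, fun hx' => hsurj x' hx'⟩

end Cover

/-! ### The degree of a finite-to-one factor code -/

section Degree

variable {A B : Type*} [TopologicalSpace A] [TopologicalSpace B] {X : Subshift A ℤ}
  {Y : Subshift B ℤ}

lemma IsDoublyTransitive.visits {y : Y.carrier} (hy : IsDoublyTransitive Y y) {y' : ℤ → B}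
    (hy' : y' ∈ Y.carrier) : RVisits y.1 y' ∧ LVisits y.1 y' := by
  have key : ∀ N : ℕ, (∃ m : ℤ, N ≤ m ∧ ∀ i : ℤ, -(N : ℤ) ≤ i → i ≤ N → y.1 (m + i) = y' i) ∧
      ∃ m : ℤ, m ≤ -N ∧ ∀ i : ℤ, -(N : ℤ) ≤ i → i ≤ N → y.1 (m + i) = y' i := by
    intro N
    let w := List.ofFn fun k : Fin (2 * N + 1) => y' (-N + (k : ℕ))
    have hw : w ∈ language Y := ⟨y', hy', -N, fun k => by simp [w, -List.ofFn_succ]⟩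
    have hwl : w.length = 2 * N + 1 := by simp [w, -List.ofFn_succ]
    have hat : ∀ m : ℤ, WordAt y.1 w (m - N) →
        ∀ i : ℤ, -(N : ℤ) ≤ i → i ≤ N → y.1 (m + i) = y' i := by
      intro m hm i h1 h2
      have := hm ⟨(N + i).toNat, by omega⟩
      simp only [w, List.get_eq_getElem, List.getElem_ofFn] at this
      rw [Int.toNat_of_nonneg (by omega)] at this
      convert this using 2 <;> ring
    obtain ⟨i, hi, hiw⟩ := (hy w hw).1 0
    obtain ⟨j, hj, hjw⟩ := (hy w hw).2 (-2 * N)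
    exact ⟨⟨i + N, by omega, hat _ (by simpa using hiw)⟩,
      ⟨j + N, by omega, hat _ (by simpa using hjw)⟩⟩
  exact ⟨fun N => (key N).1, fun N => (key N).2⟩

lemma IsFactorCode.apply_shift {π : X.carrier → Y.carrier} (hπ : IsFactorCode π) (m : ℤ)
    (x : X.carrier) : (π ⟨shift m x.1, X.mapsTo m x.2⟩).1 = shift m (π x).1 := by
  have h1 : ∀ x : X.carrier, (π ⟨shift 1 x.1, X.mapsTo 1 x.2⟩).1 = shift 1 (π x).1 :=
    fun x => congrArg Subtype.val (hπ.semiconj x)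
  induction m using Int.induction_on with
  | zero => simp
  | succ n ih =>
    have h3 : (⟨shift ((n : ℤ) + 1) x.1, X.mapsTo (n + 1) x.2⟩ : X.carrier) =
        ⟨shift 1 (shift (n : ℤ) x.1), X.mapsTo 1 (X.mapsTo n x.2)⟩ :=
      Subtype.ext (SymbolicDynamics.FullShift.shift_add _ _ _)
    rw [h3, h1 ⟨shift (n : ℤ) x.1, X.mapsTo n x.2⟩, ih, SymbolicDynamics.FullShift.shift_add]
  | pred n ih =>
    have h2 := h1 ⟨shift (-(n : ℤ) - 1) x.1, X.mapsTo (-n - 1) x.2⟩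
    have h3 : (⟨shift 1 (shift (-(n : ℤ) - 1) x.1), X.mapsTo 1 (X.mapsTo (-n - 1) x.2)⟩ :
        X.carrier) = ⟨shift (-(n : ℤ)) x.1, X.mapsTo (-n) x.2⟩ := by
      refine Subtype.ext ?_
      change shift 1 (shift (-(n : ℤ) - 1) x.1) = _
      rw [← SymbolicDynamics.FullShift.shift_add, sub_add_cancel]
    rw [h3, ih] at h2
    funext k
    have h4 := congrFun h2 (-1 + k)
    simp only [SymbolicDynamics.FullShift.shift_apply] at h4 ⊢
    rw [show (1 : ℤ) + (-1 + k) = k by ring] at h4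
    rw [← h4]
    ring_nf

/-- A continuous map from a shift space to a discrete space depends on a central window only. -/
lemma exists_window_radius [Finite A] [DiscreteTopology A] [DiscreteTopology B]
    {f : X.carrier → B} (hf : Continuous f) :
    ∃ r : ℕ, ∀ x x' : X.carrier, (∀ k : ℤ, -(r : ℤ) ≤ k → k ≤ r → x.1 k = x'.1 k) →
      f x = f x' := by
  have : CompactSpace X.carrier := isCompact_iff_compactSpace.1 X.isClosed.isCompact
  have hloc : ∀ x : X.carrier, ∃ N : ℕ, ∀ x' : X.carrier,
      (∀ k : ℤ, -(N : ℤ) ≤ k → k ≤ N → x'.1 k = x.1 k) → f x' = f x := by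
    intro x
    obtain ⟨O, hO, hOf⟩ := (isOpen_discrete {f x}).preimage hf
    have hx : x ∈ Subtype.val ⁻¹' O := by rw [hOf]; rfl
    obtain ⟨N, hN⟩ := exists_window_subset hO hx
    refine ⟨N, fun x' hx' => ?_⟩
    have : x' ∈ Subtype.val ⁻¹' O := hN _ hx'
    rwa [hOf] at this
  choose N hN using hloc
  obtain ⟨t, -, ht⟩ := isCompact_univ.elim_nhds_subcover
    (fun x : X.carrier => {x' | ∀ k ∈ Set.Icc (-(N x : ℤ)) (N x), x'.1 (0 + k) = x.1 k})
    fun x _ => ((isOpen_window (N x) 0 x.1).preimage continuous_subtype_val).mem_nhds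
      fun k _ => by simp
  refine ⟨t.sup N, fun x x' h => ?_⟩
  obtain ⟨x₀, hx₀, hx⟩ := Set.mem_iUnion₂.1 (ht (Set.mem_univ x))
  have hle : N x₀ ≤ t.sup N := Finset.le_sup hx₀
  have h1 : ∀ k : ℤ, -(N x₀ : ℤ) ≤ k → k ≤ N x₀ → x.1 k = x₀.1 k := fun k h1 h2 => by
    simpa using hx k ⟨h1, h2⟩
  rw [hN x₀ x h1, hN x₀ x' fun k h2 h3 => by rw [← h k (by omega) (by omega), h1 k h2 h3]]

/-- All doubly transitive points have the same number of preimages under a finite-to-one factor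
code on a sofic shift. With a transitive cover `L : W → X`, both `π ∘ L` and `L` have
constant fiber cardinalities, over the doubly transitive points `y` and over their preimages
respectively, and the latter divides the former with quotient the number of preimages of `y`. -/
theorem IsFactorCode.ncard_fiber_eq [Finite A] [DiscreteTopology A] [DiscreteTopology B]
    {π : X.carrier → Y.carrier} (hπ : IsFactorCode π) (hfin : IsFiniteToOne π) (hX : IsSofic X)
    {x : X.carrier} (hx : IsDoublyTransitive X x) {y y' : Y.carrier}
    (hy : IsDoublyTransitive Y y) (hy' : IsDoublyTransitive Y y') :
    (π ⁻¹' {y}).ncard = (π ⁻¹' {y'}).ncard := by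
  classical
  obtain ⟨S, _, W, L, hL, hLW⟩ := exists_transitive_cover hX x.2 fun x' hx' => (hx.visits hx').1
  have hLX : ∀ g ∈ W, L g ∈ X.carrier := fun g hg => hLW ▸ ⟨g, hg, rfl⟩
  -- the extension of `π` to all sequences by a constant
  let P : (ℤ → A) → ℤ → B := fun x => if h : x ∈ X.carrier then (π ⟨x, h⟩).1 else y.1
  have hP : ∀ x : X.carrier, P x.1 = (π x).1 := fun x => dif_pos x.2
  obtain ⟨r, hr⟩ := exists_window_radius (f := fun x => (π x).1 0)
    ((continuous_apply 0).comp (continuous_subtype_val.comp hπ.continuous))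
  have hPshift : ∀ (x : X.carrier) (i : ℤ),
      P x.1 i = (π ⟨shift i x.1, X.mapsTo i x.2⟩).1 0 := fun x i => by
    rw [hP, hπ.apply_shift]; simp
  have hΦ : IsTransitiveCode r W (P ∘ L) := by
    refine ⟨hL.markov, fun g hg g' hg' i j h => ?_, fun z => ?_, hL.exists_transitive⟩
    · rw [Function.comp, Function.comp, hPshift ⟨_, hLX g hg⟩, hPshift ⟨_, hLX g' hg'⟩]
      refine hr _ _ fun k h1 h2 => hL.isLocal g hg g' hg' _ _ fun l h3 h4 => ?_
      obtain rfl : l = 0 := by push_cast at h3 h4; omega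
      simpa using h k h1 h2
    · by_cases hz : z ∈ Y.carrier
      · refine ((hfin ⟨z, hz⟩).biUnion fun x _ => hL.finite x.1).subset fun g hg => ?_
        refine Set.mem_biUnion (x := ⟨L g, hLX g hg.1⟩) (Subtype.ext ?_) ⟨hg.1, rfl⟩
        rw [← hP]; exact hg.2
      · refine Set.finite_empty.subset fun g hg => hz ?_
        rw [← hg.2, Function.comp, hP ⟨L g, hLX g hg.1⟩]
        exact Subtype.prop _
  have hΦY : ∀ u ∈ W, (P ∘ L) u ∈ Y.carrier := fun u hu => by
    rw [Function.comp, hP ⟨L u, hLX u hu⟩]; exact Subtype.prop _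
  have hvis : ∀ y : Y.carrier, IsDoublyTransitive Y y → ∀ g ∈ fiberOn W (P ∘ L) y.1,
      ∀ u ∈ W, RVisits (L g) (L u) ∧ LVisits (L g) (L u) := by
    intro y hy g hg u hu
    have := hΦ.visits (fun u hu => hy.visits (hΦY u hu)) hg hu
    exact ⟨hL.isLocal.rVisits hg.1 hu this.1, hL.isLocal.lVisits hg.1 hu this.2⟩
  have hlift : ∀ (y : Y.carrier) (x : X.carrier), π x = y →
      ∃ g ∈ fiberOn W (P ∘ L) y.1, L g = x.1 := by
    rintro _ x rfl
    obtain ⟨g, hg, hgx⟩ : x.1 ∈ L '' W := by rw [hLW]; exact x.2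
    exact ⟨g, ⟨hg, by rw [Function.comp, hgx, hP]⟩, hgx⟩
  have hLle : ∀ y y' : Y.carrier, IsDoublyTransitive Y y → IsDoublyTransitive Y y' →
      ∀ x x' : X.carrier, π x = y → π x' = y' →
      (fiberOn W L x.1).ncard ≤ (fiberOn W L x'.1).ncard := by
    intro y y' hy hy' x x' hx hx'
    obtain ⟨g, hg, hgx⟩ := hlift y x hx
    obtain ⟨g', hg', hgx'⟩ := hlift y' x' hx'
    rw [← hgx, ← hgx']
    exact hL.ncard_fiberOn_le (hvis y hy g hg g hg.1).1 (hvis y hy g hg g hg.1).2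
      (hvis y hy g hg g' hg'.1).1
  obtain ⟨x₀, hx₀⟩ := hπ.surjective y
  have hcount : ∀ y' : Y.carrier, IsDoublyTransitive Y y' → (fiberOn W (P ∘ L) y'.1).ncard =
      (π ⁻¹' {y'}).ncard * (fiberOn W L x₀.1).ncard := by
    intro y' hy'
    have hmaps : Set.MapsTo L ((hΦ.finite y'.1).toFinset : Set (ℤ → S))
        (((hfin y').image Subtype.val).toFinset : Set (ℤ → A)) := by
      intro g hg
      simp only [Set.Finite.coe_toFinset] at hg ⊢
      refine ⟨⟨L g, hLX g hg.1⟩, Subtype.ext ?_, rfl⟩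
      rw [← hP]; exact hg.2
    rw [Set.ncard_eq_toFinset_card _ (hΦ.finite y'.1), Finset.card_eq_sum_card_fiberwise hmaps,
      Finset.sum_const_nat (m := (fiberOn W L x₀.1).ncard),
      ← Set.ncard_eq_toFinset_card _ ((hfin y').image Subtype.val),
      Set.ncard_image_of_injective _ Subtype.val_injective]
    intro x hx
    rw [Set.Finite.mem_toFinset] at hx
    obtain ⟨x, hx, rfl⟩ := hx
    rw [le_antisymm (hLle y y' hy hy' x₀ x hx₀ hx) (hLle y' y hy' hy x x₀ hx hx₀),
      ← Set.ncard_coe_finset]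
    congr 1
    ext g
    simp only [Finset.coe_filter, Set.Finite.mem_toFinset, fiberOn, Set.mem_ofPred_eq,
      Function.comp]
    refine ⟨fun h => ⟨h.1.1, h.2⟩, fun h => ⟨⟨h.1, ?_⟩, h.2⟩⟩
    rw [h.2, hP, show π x = y' from hx]
  have hpos : 0 < (fiberOn W L x₀.1).ncard := by
    obtain ⟨g, hg, hgx⟩ := hlift y x₀ hx₀
    exact (Set.ncard_pos (hL.finite _)).2 ⟨g, hg.1, hgx⟩
  obtain ⟨x₁, hx₁⟩ := hπ.surjective y'
  obtain ⟨g, hg, -⟩ := hlift y x₀ hx₀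
  obtain ⟨g', hg', -⟩ := hlift y' x₁ hx₁
  refine Nat.eq_of_mul_eq_mul_right hpos ?_
  rw [← hcount y hy, ← hcount y' hy']
  exact le_antisymm
    (hΦ.ncard_fiberOn_le (hy.visits y.2).1 (hy.visits y.2).2 (hy.visits y'.2).1)
    (hΦ.ncard_fiberOn_le (hy'.visits y'.2).1 (hy'.visits y'.2).2 (hy'.visits y.2).1)

/-- The number of preimages of any doubly transitive point is the degree. -/
theorem IsFactorCode.encard_fiber_eq_degree [Finite A] [DiscreteTopology A] [DiscreteTopology B]
    {π : X.carrier → Y.carrier} (hπ : IsFactorCode π) (hfin : IsFiniteToOne π) (hX : IsSofic X)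
    {x : X.carrier} (hx : IsDoublyTransitive X x) {y : Y.carrier}
    (hy : IsDoublyTransitive Y y) : (π ⁻¹' {y}).encard = degree π := by
  have hne : {d : ℕ | ∀ y : Y.carrier, IsDoublyTransitive Y y →
      (π ⁻¹' {y}).encard = d}.Nonempty :=
    ⟨(π ⁻¹' {y}).ncard, fun y' hy' => by
      rw [hπ.ncard_fiber_eq hfin hX hx hy hy', (hfin y').cast_ncard_eq]⟩
  exact Nat.sInf_mem hne y hy

end Degree

/-! ### The pointwise ergodic theorem for bounded functions -/

section Birkhoff

variable {X : Type*}

/-- The maximum of the first `n + 1` Birkhoff sums of `f`, the empty sum included. -/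
noncomputable def maxBirkhoffSum (T : X → X) (f : X → ℝ) : ℕ → X → ℝ
  | 0 => fun _ => 0
  | n + 1 => fun x => max 0 (f x + maxBirkhoffSum T f n (T x))

lemma birkhoffSum_le_max (T : X → X) (f : X → ℝ) (n : ℕ) (x : X) :
    birkhoffSum T f n x ≤ maxBirkhoffSum T f n x := by
  induction n generalizing x with
  | zero => simp [maxBirkhoffSum]
  | succ n ih =>
    rw [birkhoffSum_succ']
    exact (add_le_add_right (ih (T x)) (f x)).trans (le_max_right _ _)

lemma maxBirkhoffSum_nonneg (T : X → X) (f : X → ℝ) (n : ℕ) (x : X) :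
    0 ≤ maxBirkhoffSum T f n x := by
  cases n with
  | zero => simp [maxBirkhoffSum]
  | succ n => exact le_max_left _ _

lemma maxBirkhoffSum_le_succ (T : X → X) (f : X → ℝ) (n : ℕ) (x : X) :
    maxBirkhoffSum T f n x ≤ maxBirkhoffSum T f (n + 1) x := by
  induction n generalizing x with
  | zero => exact maxBirkhoffSum_nonneg T f 1 x
  | succ n ih => exact max_le_max le_rfl (add_le_add_right (ih (T x)) (f x))

lemma maxBirkhoffSum_le {T : X → X} {f : X → ℝ} {C : ℝ} (hC : ∀ x, |f x| ≤ C) (n : ℕ) (x : X) :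
    maxBirkhoffSum T f n x ≤ n * C := by
  have hC0 : 0 ≤ C := (abs_nonneg _).trans (hC x)
  induction n generalizing x with
  | zero => simp [maxBirkhoffSum]
  | succ n ih =>
    refine max_le (by positivity) ?_
    have := (abs_le.1 (hC x)).2
    push_cast
    linarith [ih (T x)]

variable [MeasurableSpace X] {T : X → X} {μ : Measure X}

lemma measurable_maxBirkhoffSum (hT : Measurable T) {f : X → ℝ} (hf : Measurable f) (n : ℕ) :
    Measurable (maxBirkhoffSum T f n) := by
  induction n with
  | zero => exact measurable_const
  | succ n ih => exact measurable_const.max (hf.add (ih.comp hT))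

/-- If `∫ f < 0`, then the Birkhoff sums of `f` are almost everywhere bounded above. Otherwise the
maximal sums `M n` tend to infinity almost everywhere, hence `M (n + 1) - M n ∘ T` tends to `f`;
but the integral of this difference is nonnegative. -/
theorem ae_bddAbove_maxBirkhoffSum [IsProbabilityMeasure μ] (hμ : Ergodic T μ) {f : X → ℝ}
    (hf : Measurable f) {C : ℝ} (hC : ∀ x, |f x| ≤ C) (hneg : ∫ x, f x ∂μ < 0) :
    ∀ᵐ x ∂μ, ∃ K : ℕ, ∀ n, maxBirkhoffSum T f n x ≤ K := by
  set M := maxBirkhoffSum T f with hM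
  have hMm : ∀ n, Measurable (M n) := measurable_maxBirkhoffSum hμ.measurable hf
  let E : Set X := ⋃ K : ℕ, ⋂ n, {x | M n x ≤ K}
  have hEmem : ∀ x, x ∈ E ↔ ∃ K : ℕ, ∀ n, M n x ≤ K := fun x => by simp [E]
  have hEm : MeasurableSet E := .iUnion fun K => .iInter fun n =>
    measurableSet_le (hMm n) measurable_const
  have hEinv : T ⁻¹' E = E := by
    ext x
    rw [Set.mem_preimage, hEmem, hEmem]
    constructor
    · rintro ⟨K, hK⟩
      obtain ⟨K', hK'⟩ := exists_nat_ge (max 0 (f x + K))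
      refine ⟨K', fun n => ((maxBirkhoffSum_le_succ T f n x).trans ?_).trans hK'⟩
      exact max_le_max le_rfl (add_le_add_right (hK n) (f x))
    · rintro ⟨K, hK⟩
      obtain ⟨K', hK'⟩ := exists_nat_ge (K - f x)
      refine ⟨K', fun n => ?_⟩
      have : f x + M n (T x) ≤ M (n + 1) x := le_max_right _ _
      linarith [hK (n + 1)]
  rcases hμ.toPreErgodic.ae_mem_or_ae_notMem hEm hEinv with h | h
  · filter_upwards [h] with x hx using (hEmem x).1 hx
  exfalso
  have hint : ∀ n, Integrable (M n) μ := fun n =>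
    Integrable.of_bound (hMm n).aestronglyMeasurable (n * C) (ae_of_all _ fun x => by
      rw [Real.norm_of_nonneg (maxBirkhoffSum_nonneg T f n x)]
      exact maxBirkhoffSum_le hC n x)
  have hlim : Tendsto (fun n => ∫ x, M (n + 1) x - M n (T x) ∂μ) atTop (𝓝 (∫ x, f x ∂μ)) := by
    refine tendsto_integral_of_dominated_convergence (fun _ => C)
      (fun n => ((hMm (n + 1)).sub ((hMm n).comp hμ.measurable)).aestronglyMeasurable)
      (integrable_const C) (fun n => ae_of_all _ fun x => ?_) ?_
    · have h0 := maxBirkhoffSum_nonneg T f n (T x)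
      have h1 := abs_le.1 (hC x)
      have h2 : f x + M n (T x) ≤ M (n + 1) x := le_max_right _ _
      have h3 : M (n + 1) x ≤ C + M n (T x) := max_le (by linarith) (by linarith)
      rw [Real.norm_eq_abs, abs_le]
      constructor <;> linarith
    · filter_upwards [h] with x hx
      have hTx : T x ∉ E := fun h' => hx (hEinv ▸ h')
      rw [hEmem] at hTx
      push Not at hTx
      obtain ⟨K, hK⟩ := exists_nat_ge (-f x)
      obtain ⟨n₀, hn₀⟩ := hTx K
      refine tendsto_const_nhds.congr' ?_
      filter_upwards [eventually_ge_atTop n₀] with n hn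
      have h1 : M n₀ (T x) ≤ M n (T x) :=
        monotone_nat_of_le_succ (fun n => maxBirkhoffSum_le_succ T f n (T x)) hn
      have h2 : M (n + 1) x = f x + M n (T x) := max_eq_right (by linarith)
      rw [h2]; ring
  refine hneg.not_ge (ge_of_tendsto' hlim fun n => ?_)
  have hcomp : ∫ x, M n (T x) ∂μ = ∫ x, M n x ∂μ := by
    have := integral_map (f := M n) (μ := μ) hμ.measurable.aemeasurable
      (hMm n).aestronglyMeasurable
    rw [← this, hμ.toMeasurePreserving.map_eq]
  have hintT : Integrable (fun x => M n (T x)) μ :=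
    hμ.toMeasurePreserving.integrable_comp_of_integrable (hint n)
  rw [integral_sub (hint (n + 1)) hintT, hcomp, sub_nonneg]
  exact integral_mono (hint n) (hint (n + 1)) (maxBirkhoffSum_le_succ T f n)

lemma ae_eventually_birkhoffAverage_lt [IsProbabilityMeasure μ] (hμ : Ergodic T μ) {f : X → ℝ}
    (hf : Measurable f) {C : ℝ} (hC : ∀ x, |f x| ≤ C) {c : ℝ} (hc : ∫ x, f x ∂μ < c) :
    ∀ᵐ x ∂μ, ∀ᶠ n in atTop, birkhoffAverage ℝ T f n x < c := by
  set b := (∫ x, f x ∂μ + c) / 2 with hb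
  have hfi : Integrable f μ := Integrable.of_bound hf.aestronglyMeasurable C (ae_of_all _ hC)
  have hneg : ∫ x, (f x - b) ∂μ < 0 := by
    rw [integral_sub hfi (integrable_const b)]
    simp only [integral_const, probReal_univ, smul_eq_mul, one_mul]
    linarith
  filter_upwards [ae_bddAbove_maxBirkhoffSum hμ (hf.sub_const b) (C := C + |b|)
    (fun x => (abs_sub _ _).trans (add_le_add_left (hC x) _)) hneg] with x ⟨K, hK⟩
  have hlim : Tendsto (fun n : ℕ => b + K / n) atTop (𝓝 (b + 0)) :=
    tendsto_const_nhds.add (tendsto_const_div_atTop_nhds_zero_nat _)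
  have hbc : b + 0 < c := by linarith
  filter_upwards [hlim.eventually (gt_mem_nhds hbc), eventually_gt_atTop 0] with n hn hn0
  refine lt_of_le_of_lt ?_ hn
  have hn0' : (0 : ℝ) < n := by exact_mod_cast hn0
  have h1 := (birkhoffSum_le_max T (fun x => f x - b) n x).trans (hK n)
  have h2 : birkhoffSum T (fun x => f x - b) n x = birkhoffSum T f n x - n * b := by
    simp [birkhoffSum, Finset.sum_sub_distrib]
  rw [birkhoffAverage, smul_eq_mul, inv_mul_eq_div, div_le_iff₀ hn0', add_mul,
    div_mul_cancel₀ _ hn0'.ne']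
  linarith

/-- The pointwise ergodic theorem for bounded functions. -/
theorem ae_tendsto_birkhoffAverage [IsProbabilityMeasure μ] (hμ : Ergodic T μ) {f : X → ℝ}
    (hf : Measurable f) {C : ℝ} (hC : ∀ x, |f x| ≤ C) :
    ∀ᵐ x ∂μ, Tendsto (fun n => birkhoffAverage ℝ T f n x) atTop (𝓝 (∫ x, f x ∂μ)) := by
  have h1 : ∀ᵐ x ∂μ, ∀ k : ℕ, ∀ᶠ n in atTop,
      birkhoffAverage ℝ T f n x < ∫ x, f x ∂μ + 1 / ((k : ℝ) + 1) :=
    ae_all_iff.2 fun k => ae_eventually_birkhoffAverage_lt hμ hf hC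
      (lt_add_of_pos_right _ (by positivity))
  have h2 : ∀ᵐ x ∂μ, ∀ k : ℕ, ∀ᶠ n in atTop,
      birkhoffAverage ℝ T (-f) n x < -∫ x, f x ∂μ + 1 / ((k : ℝ) + 1) :=
    ae_all_iff.2 fun k => ae_eventually_birkhoffAverage_lt hμ hf.neg (C := C)
      (fun x => by simpa using hC x) (by
        simp only [Pi.neg_apply, integral_neg]
        exact lt_add_of_pos_right _ (by positivity))
  filter_upwards [h1, h2] with x hx1 hx2
  rw [Metric.tendsto_atTop']
  intro ε hε
  obtain ⟨k, hk⟩ := exists_nat_one_div_lt hε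
  obtain ⟨N, hN⟩ := eventually_atTop.1 ((hx1 k).and (hx2 k))
  refine ⟨N, fun n hn => ?_⟩
  obtain ⟨h3, h4⟩ := hN n hn.le
  rw [birkhoffAverage_neg, Pi.neg_apply, Pi.neg_apply] at h4
  rw [Real.dist_eq, abs_lt]
  constructor <;> linarith

end Birkhoff

/-! ### Generic points -/

section Generic

variable {X : Type*} [TopologicalSpace X] [CompactSpace X] {T : X → X}

lemma dist_birkhoffAverage_le (f g : C(X, ℝ)) (n : ℕ) (x : X) :
    dist (birkhoffAverage ℝ T f n x) (birkhoffAverage ℝ T g n x) ≤ dist f g := by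
  have h : birkhoffAverage ℝ T f n x - birkhoffAverage ℝ T g n x =
      (n : ℝ)⁻¹ * ∑ k ∈ Finset.range n, (f (T^[k] x) - g (T^[k] x)) := by
    simp [birkhoffAverage, birkhoffSum, Finset.sum_sub_distrib, mul_sub]
  rw [Real.dist_eq, h, abs_mul, abs_inv, Nat.abs_cast]
  have hle : |∑ k ∈ Finset.range n, (f (T^[k] x) - g (T^[k] x))| ≤ n * dist f g := by
    refine (Finset.abs_sum_le_sum_abs _ _).trans ?_
    calc _ ≤ ∑ _k ∈ Finset.range n, dist f g :=
          Finset.sum_le_sum fun k _ => ContinuousMap.dist_apply_le_dist (f := f) (g := g) _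
      _ = n * dist f g := by simp
  rcases Nat.eq_zero_or_pos n with rfl | hn
  · simp
  · rw [inv_mul_le_iff₀ (by exact_mod_cast hn)]
    exact hle

variable [MeasurableSpace X] [BorelSpace X]

lemma dist_integral_le (μ : Measure X) [IsProbabilityMeasure μ] (f g : C(X, ℝ)) :
    dist (∫ x, f x ∂μ) (∫ x, g x ∂μ) ≤ dist f g := by
  have hint : ∀ f : C(X, ℝ), Integrable f μ := fun f =>
    Integrable.of_bound f.continuous.aestronglyMeasurable ‖f‖
      (ae_of_all _ fun x => f.norm_coe_le_norm x)
  rw [Real.dist_eq, ← integral_sub (hint f) (hint g), ← Real.norm_eq_abs]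
  refine (norm_integral_le_of_norm_le_const (C := dist f g) (ae_of_all _ fun x => ?_)).trans
    (by simp)
  exact ContinuousMap.dist_apply_le_dist (f := f) (g := g) x

variable [T2Space X] [SecondCountableTopology X]

/-- It suffices to test genericity on a dense sequence of continuous functions. -/
lemma genericPoints_eq_iInter (T : X → X) (μ : Measure X) [IsProbabilityMeasure μ] :
    genericPoints T μ = ⋂ k : ℕ, {x | Tendsto (fun n => birkhoffAverage ℝ T
      (TopologicalSpace.denseSeq C(X, ℝ) k) n x) atTop
      (𝓝 (∫ z, TopologicalSpace.denseSeq C(X, ℝ) k z ∂μ))} := by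
  ext x
  simp only [genericPoints, Set.mem_iInter]
  refine ⟨fun h k => h _, fun h f => Metric.tendsto_atTop.2 fun ε hε => ?_⟩
  obtain ⟨k, hk⟩ := (TopologicalSpace.denseRange_denseSeq C(X, ℝ)).exists_dist_lt f
    (show 0 < ε / 3 by linarith)
  set g := TopologicalSpace.denseSeq C(X, ℝ) k
  obtain ⟨N, hN⟩ := Metric.tendsto_atTop.1 (h k) (ε / 3) (by linarith)
  refine ⟨N, fun n hn => ?_⟩
  have h1 := dist_birkhoffAverage_le (T := T) f g n x
  have h2 := dist_integral_le μ f g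
  have h3 := hN n hn
  have h4 := dist_triangle4_right (birkhoffAverage ℝ T f n x) (∫ z, f z ∂μ)
    (birkhoffAverage ℝ T g n x) (∫ z, g z ∂μ)
  linarith

lemma measurableSet_genericPoints (hT : Measurable T) (μ : Measure X) [IsProbabilityMeasure μ] :
    MeasurableSet (genericPoints T μ) := by
  rw [genericPoints_eq_iInter]
  refine .iInter fun k => measurableSet_tendsto _ fun n => ?_
  let f := TopologicalSpace.denseSeq C(X, ℝ) k
  have hf : Measurable fun x => ∑ i ∈ Finset.range n, f (T^[i] x) :=
    Finset.measurable_sum (Finset.range n) fun i _ =>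
      f.continuous.measurable.comp (hT.iterate i)
  exact hf.const_mul (n : ℝ)⁻¹

theorem ae_mem_genericPoints {μ : Measure X} [IsProbabilityMeasure μ] (hμ : Ergodic T μ) :
    ∀ᵐ x ∂μ, x ∈ genericPoints T μ := by
  rw [genericPoints_eq_iInter]
  refine (ae_all_iff.2 fun k => ?_).mono fun x hx => Set.mem_iInter.2 hx
  let f := TopologicalSpace.denseSeq C(X, ℝ) k
  exact ae_tendsto_birkhoffAverage hμ f.continuous.measurable (C := ‖f‖) f.norm_coe_le_norm

/-- A point is generic for at most one measure. -/
lemma eq_of_mem_genericPoints {μ μ' : Measure X} [IsProbabilityMeasure μ]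
    [IsProbabilityMeasure μ'] {x : X} (h : x ∈ genericPoints T μ) (h' : x ∈ genericPoints T μ') :
    μ = μ' :=
  ext_of_forall_integral_eq_of_IsFiniteMeasure fun f =>
    tendsto_nhds_unique (h f.toContinuousMap) (h' f.toContinuousMap)

end Generic

/-! ### Counting measures on finite fibers -/

section FiberCount

variable {Z Y : Type*}

/-- The points over which a closed set has at least `k` points form a measurable set: it is the
union over `n` of the images of the compact sets of `k`-tuples within a fiber which are pairwise
at distance at least `1 / (n + 1)`. -/
lemma measurableSet_le_ncard_fiber [TopologicalSpace Z] [CompactSpace Z] [T2Space Z]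
    [SecondCountableTopology Z] [TopologicalSpace Y] [T2Space Y] [MeasurableSpace Y]
    [BorelSpace Y] {q : Z → Y} (hq : Continuous q) {C : Set Z}
    (hC : IsClosed C) (hfin : ∀ y, (C ∩ q ⁻¹' {y}).Finite) (k : ℕ) :
    MeasurableSet {y | k ≤ (C ∩ q ⁻¹' {y}).ncard} := by
  let := TopologicalSpace.metrizableSpaceMetric Z
  rcases Nat.eq_zero_or_pos k with rfl | hk
  · simp
  let i₀ : Fin k := ⟨0, hk⟩
  let K : ℕ → Set (Fin k → Z) := fun n => {x | (∀ i, x i ∈ C) ∧ (∀ i, q (x i) = q (x i₀)) ∧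
    ∀ i j, i ≠ j → 1 / ((n : ℝ) + 1) ≤ dist (x i) (x j)}
  have hK : ∀ n, IsClosed (K n) := by
    intro n
    have h1 : IsClosed {x : Fin k → Z | ∀ i, x i ∈ C} := by
      simp only [Set.ofPred_forall]
      exact isClosed_iInter fun i => hC.preimage (continuous_apply i)
    have h2 : IsClosed {x : Fin k → Z | ∀ i, q (x i) = q (x i₀)} := by
      simp only [Set.ofPred_forall]
      exact isClosed_iInter fun i =>
        isClosed_eq (hq.comp (continuous_apply i)) (hq.comp (continuous_apply i₀))
    have h3 : IsClosed {x : Fin k → Z | ∀ i j, i ≠ j →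
        1 / ((n : ℝ) + 1) ≤ dist (x i) (x j)} := by
      simp only [Set.ofPred_forall]
      exact isClosed_iInter fun i => isClosed_iInter fun j =>
        isClosed_iInter fun _ => isClosed_le continuous_const
          ((continuous_apply i).dist (continuous_apply j))
    exact h1.inter (h2.inter h3)
  have heq : {y | k ≤ (C ∩ q ⁻¹' {y}).ncard} = ⋃ n, (fun x => q (x i₀)) '' K n := by
    ext y
    simp only [Set.mem_iUnion, Set.mem_image]
    constructor
    · intro hy
      have : Finite ↥(C ∩ q ⁻¹' {y}) := (hfin y).to_subtype
      have := Fintype.ofFinite ↥(C ∩ q ⁻¹' {y})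
      obtain ⟨f⟩ : Nonempty (Fin k ↪ ↥(C ∩ q ⁻¹' {y})) := by
        refine Function.Embedding.nonempty_of_card_le ?_
        rw [Fintype.card_fin, Fintype.card_eq_nat_card, Nat.card_coe_set_eq]
        exact hy
      have hmin : ∃ ε > 0, ∀ p : Fin k × Fin k, p.1 ≠ p.2 →
          ε ≤ dist (f p.1).1 (f p.2).1 := by
        have : ∀ p : Fin k × Fin k, ∀ᶠ ε in 𝓝[>] (0 : ℝ), p.1 ≠ p.2 →
            ε ≤ dist (f p.1).1 (f p.2).1 := by
          intro p
          by_cases hp : p.1 = p.2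
          · simp [hp]
          · have : 0 < dist (f p.1).1 (f p.2).1 :=
              dist_pos.2 fun h => hp (f.injective (Subtype.ext h))
            filter_upwards [Ioc_mem_nhdsGT this] with ε hε _ using hε.2
        obtain ⟨ε, hε, hε0⟩ := ((eventually_all.2 this).and self_mem_nhdsWithin).exists
        exact ⟨ε, hε0, hε⟩
      obtain ⟨ε, hε0, hε⟩ := hmin
      obtain ⟨n, hn⟩ := exists_nat_one_div_lt hε0
      have hfy : ∀ i, q (f i).1 = y := fun i => (f i).2.2
      exact ⟨n, fun i => (f i).1, ⟨fun i => (f i).2.1, fun i => by rw [hfy, hfy],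
        fun i j hij => hn.le.trans (hε (i, j) hij)⟩, hfy i₀⟩
    · rintro ⟨n, x, ⟨h1, h2, h3⟩, rfl⟩
      have hinj : Function.Injective x := by
        intro i j hij
        by_contra hne
        have := h3 i j hne
        rw [hij, dist_self] at this
        exact absurd this (not_le.2 (by positivity))
      have hsub : Set.range x ⊆ C ∩ q ⁻¹' {q (x i₀)} := by
        rintro _ ⟨i, rfl⟩
        exact ⟨h1 i, h2 i⟩
      have := Set.ncard_le_ncard hsub (hfin _)
      rwa [← Set.image_univ, Set.ncard_image_of_injective _ hinj, Set.ncard_univ,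
        Nat.card_eq_fintype_card, Fintype.card_fin] at this
  rw [heq]
  exact .iUnion fun n => ((hK n).isCompact.image (hq.comp (continuous_apply i₀))).measurableSet

variable [MeasurableSpace Z]

/-- The counting measure on the part in `D` of the fiber of `q` over `y`. -/
noncomputable def fiberCount (q : Z → Y) (D : Set Z) (y : Y) : Measure Z :=
  Measure.count.restrict (D ∩ q ⁻¹' {y})

lemma fiberCount_apply (q : Z → Y) (D : Set Z) (y : Y) {A : Set Z} (hA : MeasurableSet A)
    [MeasurableSingletonClass Z] (hfin : (D ∩ q ⁻¹' {y}).Finite) :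
    fiberCount q D y A = (A ∩ (D ∩ q ⁻¹' {y})).encard := by
  rw [fiberCount, Measure.restrict_apply hA,
    Measure.count_apply (hfin.subset Set.inter_subset_right).measurableSet]

lemma fiberCount_univ [MeasurableSingletonClass Z] {q : Z → Y} {D : Set Z} {y : Y}
    (hfin : (D ∩ q ⁻¹' {y}).Finite) :
    fiberCount q D y Set.univ = (D ∩ q ⁻¹' {y}).encard := by
  rw [fiberCount_apply q D y .univ hfin, Set.univ_inter]

lemma isFiniteMeasure_fiberCount [MeasurableSingletonClass Z] (q : Z → Y) (D : Set Z)
    (hfin : ∀ y, (D ∩ q ⁻¹' {y}).Finite) (y : Y) : IsFiniteMeasure (fiberCount q D y) :=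
  ⟨by rw [fiberCount_univ (hfin y)]; simp [hfin y]⟩

variable [MeasurableSpace Y] [TopologicalSpace Z] [CompactSpace Z] [T2Space Z]
  [SecondCountableTopology Z] [TopologicalSpace Y] [T2Space Y]

/-- For a closed set `D`, the counting measures on the fibers form a measurable family: their values
on closed sets are measurable, and closed sets form a generating `π`-system. -/
lemma measurable_fiberCount [BorelSpace Z] [BorelSpace Y] {q : Z → Y} (hq : Continuous q)
    {D : Set Z} (hD : IsClosed D) (hfin : ∀ y, (D ∩ q ⁻¹' {y}).Finite) :
    Measurable (fiberCount q D) := by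
  have := isFiniteMeasure_fiberCount q D hfin
  have hclosed : ∀ C : Set Z, IsClosed C → Measurable fun y => fiberCount q D y C := by
    intro C hC
    have hfin' : ∀ y, ((C ∩ D) ∩ q ⁻¹' {y}).Finite := fun y =>
      (hfin y).subset fun x hx => ⟨hx.1.2, hx.2⟩
    have h1 : Measurable fun y => ((C ∩ D) ∩ q ⁻¹' {y}).ncard :=
      measurable_of_Ici fun k => measurableSet_le_ncard_fiber hq (hC.inter hD) hfin' k
    have h2 : (fun y => fiberCount q D y C) =
        fun y => ((((C ∩ D) ∩ q ⁻¹' {y}).ncard : ℕ) : ℝ≥0∞) := by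
      funext y
      rw [fiberCount_apply q D y hC.measurableSet (hfin y), ← Set.inter_assoc,
        ← (hfin' y).cast_ncard_eq]
      simp
    rw [h2]
    exact (measurable_of_countable _).comp h1
  refine Measurable.measure_of_isPiSystem (S := {s | IsClosed s}) ?_ isPiSystem_isClosed hclosed
    (hclosed _ isClosed_univ)
  rw [← borel_eq_generateFrom_isClosed]
  exact BorelSpace.measurable_eq

end FiberCount

/-! ### Ergodic lifts through finite-to-one maps -/

section Lift

variable {Z Y : Type*} [MeasurableSpace Z] [MeasurableSpace Y] [MeasurableSingletonClass Z]

/-- An ergodic measure `ν` lifts to an ergodic measure along a map `q` with finite fibers on an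
invariant set `D`. An invariant set has the same number of points in almost every fiber. For
an invariant set `E` where this number is positive and minimal, the integral over `ν` of the
counting measures on the fibers of `E` is ergodic up to a constant. -/
theorem exists_ergodic_lift (e : Z ≃ᵐ Z) {S : Y → Y} {q : Z → Y} (hq : Measurable q)
    (hS : Function.Injective S) (hsemi : Function.Semiconj q e S) {ν : Measure Y}
    [IsProbabilityMeasure ν] (hν : Ergodic S ν) {D : Set Z} (hDm : MeasurableSet D)
    (hD : e ⁻¹' D = D) (hfin : ∀ y, (D ∩ q ⁻¹' {y}).Finite)
    (hmeas : Measurable (fiberCount q D)) (hne : ∀ᵐ y ∂ν, (D ∩ q ⁻¹' {y}).Nonempty) :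
    ∃ J : Measure Z, IsProbabilityMeasure J ∧ Ergodic e J ∧ J.map q = ν ∧ ∀ᵐ z ∂J, z ∈ D := by
  have hκ : ∀ y (A : Set Z), MeasurableSet A →
      fiberCount q D y A = (A ∩ (D ∩ q ⁻¹' {y})).encard :=
    fun y A hA => fiberCount_apply q D y hA (hfin y)
  have hmap : ∀ y (A : Set Z), MeasurableSet A →
      fiberCount q D y (e ⁻¹' A) = fiberCount q D (S y) A := by
    intro y A hA
    rw [hκ _ _ (e.measurable hA), hκ _ _ hA, ← e.injective.encard_image]
    congr 2
    ext z
    obtain ⟨w, rfl⟩ := e.surjective z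
    rw [e.injective.mem_set_image]
    have hwD : w ∈ D ↔ e w ∈ D := by rw [← Set.mem_preimage, hD]
    simp only [Set.mem_inter_iff, Set.mem_preimage, Set.mem_singleton_iff, hsemi w, hS.eq_iff, hwD]
  have hev : ∀ A, MeasurableSet A → Measurable fun y => fiberCount q D y A := fun A hA =>
    (Measure.measurable_coe hA).comp hmeas
  have hconst : ∀ E : Set Z, MeasurableSet E → e ⁻¹' E = E →
      ∃ k : ℕ, ∀ᵐ y ∂ν, fiberCount q D y E = k := by
    intro E hE hEinv
    obtain ⟨c, hc⟩ : ∃ c, ∀ᵐ y ∂ν, fiberCount q D y E = c :=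
      hν.toPreErgodic.ae_eq_const_of_ae_eq_comp (hev E hE)
      (funext fun y => by simp only [Function.comp, ← hmap y E hE, hEinv])
    obtain ⟨y, hy⟩ := hc.exists
    have hfin' := (hfin y).subset (Set.inter_subset_right (s := E))
    refine ⟨(E ∩ (D ∩ q ⁻¹' {y})).ncard, ?_⟩
    filter_upwards [hc] with y' hy'
    rw [hy', ← hy, hκ y E hE, ← hfin'.cast_ncard_eq]
    simp
  classical
  let P : ℕ → Prop := fun k => k ≠ 0 ∧ ∃ E : Set Z, MeasurableSet E ∧ e ⁻¹' E = E ∧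
    ∀ᵐ y ∂ν, fiberCount q D y E = k
  have hP : ∃ k, P k := by
    obtain ⟨k, hk⟩ := hconst Set.univ .univ rfl
    refine ⟨k, ?_, Set.univ, .univ, rfl, hk⟩
    rintro rfl
    obtain ⟨y, hy, hy'⟩ := (hk.and hne).exists
    rw [hκ y _ .univ, Set.univ_inter] at hy
    simp [hy'.ne_empty] at hy
  obtain ⟨hk0, E, hE, hEinv, hEk⟩ := Nat.find_spec hP
  set k := Nat.find hP with hkdef
  have hkE : (k : ℝ≥0∞) ≠ 0 := by exact_mod_cast hk0
  have hkT : (k : ℝ≥0∞) ≠ ∞ := ENNReal.natCast_ne_top k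
  let J₀ : Measure Z := ν.bind (fiberCount q D)
  have hJ₀ : ∀ A, MeasurableSet A → J₀ A = ∫⁻ y, fiberCount q D y A ∂ν := fun A hA =>
    Measure.bind_apply hA hmeas.aemeasurable
  have hpres : MeasurePreserving e J₀ J₀ := by
    refine ⟨e.measurable, Measure.ext fun A hA => ?_⟩
    rw [Measure.map_apply e.measurable hA, hJ₀ _ (e.measurable hA), hJ₀ _ hA,
      ← hν.toMeasurePreserving.lintegral_comp (hev A hA)]
    exact lintegral_congr fun y => hmap y A hA
  let J : Measure Z := (k : ℝ≥0∞)⁻¹ • J₀.restrict E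
  have hJ : ∀ A, MeasurableSet A → J A = (k : ℝ≥0∞)⁻¹ * ∫⁻ y, fiberCount q D y (A ∩ E) ∂ν := by
    intro A hA
    rw [Measure.smul_apply, Measure.restrict_apply hA, hJ₀ _ (hA.inter hE), smul_eq_mul]
  have hJpres : MeasurePreserving e J J := by
    have := (hpres.restrict_preimage hE).smul_measure (k : ℝ≥0∞)⁻¹
    rwa [hEinv] at this
  have hJq : J.map q = ν := by
    ext A hA
    rw [Measure.map_apply hq hA, hJ _ (hq hA)]
    have : ∀ᵐ y ∂ν, fiberCount q D y (q ⁻¹' A ∩ E) = A.indicator (fun _ => (k : ℝ≥0∞)) y := by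
      filter_upwards [hEk] with y hy
      by_cases hyA : y ∈ A
      · rw [Set.indicator_of_mem hyA, ← hy, hκ _ _ ((hq hA).inter hE), hκ _ _ hE]
        congr 2
        ext z
        simp only [Set.mem_inter_iff, Set.mem_preimage, Set.mem_singleton_iff]
        refine ⟨fun h => ⟨h.1.2, h.2⟩, fun h => ⟨⟨?_, h.1⟩, h.2⟩⟩
        rw [h.2.2]; exact hyA
      · rw [Set.indicator_of_notMem hyA, hκ _ _ ((hq hA).inter hE)]
        have : (q ⁻¹' A ∩ E) ∩ (D ∩ q ⁻¹' {y}) = ∅ := by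
          refine Set.eq_empty_of_forall_notMem fun z hz => hyA ?_
          rw [← show q z = y from hz.2.2]
          exact hz.1.1
        simp [this]
    rw [lintegral_congr_ae this, lintegral_indicator hA, lintegral_const,
      Measure.restrict_apply_univ, ← mul_assoc, ENNReal.inv_mul_cancel hkE hkT, one_mul]
  have hJprob : IsProbabilityMeasure J := by
    constructor
    rw [← Set.preimage_univ (f := q), ← Measure.map_apply hq .univ, hJq, measure_univ]
  refine ⟨J, hJprob, ⟨hJpres, ⟨fun F hF hFinv => ?_⟩⟩, hJq, ?_⟩
  · rw [eventuallyConst_set']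
    obtain ⟨j, hj⟩ := hconst (F ∩ E) (hF.inter hE) (by rw [Set.preimage_inter, hFinv, hEinv])
    by_cases hj0 : j = 0
    · left
      rw [ae_eq_empty, hJ F hF, lintegral_congr_ae hj]
      simp [hj0]
    · right
      have hkj : k ≤ j := Nat.find_min' hP
        ⟨hj0, F ∩ E, hF.inter hE, by rw [Set.preimage_inter, hFinv, hEinv], hj⟩
      have h1 : 1 ≤ J F := by
        rw [hJ F hF, lintegral_congr_ae hj, lintegral_const, measure_univ, mul_one,
          ← ENNReal.inv_mul_cancel hkE hkT]
        gcongr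
      rw [ae_eq_univ, prob_compl_eq_zero_iff hF]
      exact le_antisymm prob_le_one h1
  · rw [ae_iff]
    change J Dᶜ = 0
    rw [hJ _ hDm.compl]
    have : ∀ y, fiberCount q D y (Dᶜ ∩ E) = 0 := by
      intro y
      rw [hκ _ _ (hDm.compl.inter hE)]
      have : (Dᶜ ∩ E) ∩ (D ∩ q ⁻¹' {y}) = ∅ :=
        Set.eq_empty_of_forall_notMem fun z hz => hz.1.1 hz.2.1
      simp [this]
    simp [this]

end Lift

/-! ### Joinings over a finite-to-one map -/

section Joinings

variable {X Y : Type*} [MeasurableSpace X] [MeasurableSpace Y]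

lemma measurable_fiberCount_inter [MeasurableSingletonClass X] {q : X → Y} {D E : Set X}
    (h : Measurable (fiberCount q D)) (hE : MeasurableSet E) :
    Measurable (fiberCount q (D ∩ E)) := by
  have : fiberCount q (D ∩ E) = fun y => (fiberCount q D y).restrict E := by
    funext y
    rw [fiberCount, fiberCount, Measure.restrict_restrict hE]
    congr 1
    ext x
    simp only [Set.mem_inter_iff]
    tauto
  rw [this]
  refine Measure.measurable_of_measurable_coe _ fun s hs => ?_
  simp only [Measure.restrict_apply hs]
  exact (Measure.measurable_coe (hs.inter hE)).comp h

lemma IsRelJoining.map_margin_eq {T : X → X} {π : X → Y} {n : ℕ} {J : Measure (Fin n → X)}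
    (hJ : IsRelJoining T π n J) (hπ : Measurable π) (i j : Fin n) :
    (margin J i).map π = (margin J j).map π := by
  rw [margin, margin, Measure.map_map hπ (measurable_pi_apply i),
    Measure.map_map hπ (measurable_pi_apply j)]
  exact Measure.map_congr (hJ.same_image.mono fun x hx => hx i j)

/-- Two disintegrations of a measure agree almost everywhere. -/
theorem IsDisintegration.ae_eq [MeasurableSpace.CountablyGenerated X]
    [MeasurableSingletonClass Y] {π : X → Y}
    (hπ : Measurable π) {μ : Measure X} [IsProbabilityMeasure μ] {κ κ' : Kernel Y X}
    (hκ : IsDisintegration π μ κ) (hκ' : IsDisintegration π μ κ') : κ =ᵐ[μ.map π] κ' := by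
  have := Measure.isProbabilityMeasure_map (μ := μ) hπ.aemeasurable
  have key : ∀ κ : Kernel Y X, IsDisintegration π μ κ →
      (μ.map π) ⊗ₘ κ = μ.map (fun x => (π x, x)) := by
    intro κ hκ
    have := hκ.markov
    ext s hs
    have hpair : Measurable fun x => (π x, x) := hπ.prodMk measurable_id
    rw [Measure.compProd_apply hs, Measure.map_apply hpair hs]
    conv_rhs => rw [← hκ.bind_eq, Measure.bind_apply (hpair hs) κ.aemeasurable]
    refine lintegral_congr_ae ?_
    filter_upwards [hκ.fiber] with y hy
    have hae : ∀ᵐ x ∂κ y, x ∈ π ⁻¹' {y} :=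
      (prob_compl_eq_zero_iff (hπ (measurableSet_singleton y))).2 hy
    refine measure_congr (hae.mono fun x hx => ?_)
    have hx' : π x = y := hx
    change ((y, x) ∈ s) = ((π x, x) ∈ s)
    rw [hx']
  have := hκ.markov
  have := hκ'.markov
  exact Kernel.ae_eq_of_compProd_eq ((key κ hκ).trans (key κ' hκ').symm)

variable [TopologicalSpace X] [T2Space X] [SecondCountableTopology X] [BorelSpace X] {π : X → Y}

lemma measurableSet_injective (n : ℕ) :
    MeasurableSet {x : Fin n → X | Function.Injective x} := by
  have : {x : Fin n → X | Function.Injective x} =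
      ⋂ i, ⋂ j, ⋂ (_ : i ≠ j), {x : Fin n → X | x i ≠ x j} := by
    ext x
    simp only [Set.mem_iInter, Function.Injective]
    exact ⟨fun h i j hij hx => hij (h hx), fun h i j hx => by_contra fun hij => h i j hij hx⟩
  rw [this]
  exact .iInter fun i => .iInter fun j => .iInter fun _ =>
    (isOpen_ne_fun (continuous_apply i) (continuous_apply j)).measurableSet

/-- If the conditional measures of `μ` are almost everywhere uniform on `m` points, then the
diagonal has measure `1 / m` for the relatively independent self-joining. -/
theorem relIndepSelfJoining_diagonal (hπ : Measurable π) {μ : Measure X} [IsProbabilityMeasure μ]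
    {κ : Kernel Y X} (hκ : IsDisintegration π μ κ) {F : Y → Set X} {m : ℕ}
    (hcard : ∀ᵐ y ∂μ.map π, (F y).encard = m)
    (hunif : ∀ᵐ y ∂μ.map π, κ y = uniformOn (F y)) :
    relIndepSelfJoining π μ κ {p | p.1 = p.2} = (m : ℝ≥0∞)⁻¹ := by
  have := hκ.markov
  have := Measure.isProbabilityMeasure_map (μ := μ) hπ.aemeasurable
  have hdiag : MeasurableSet {p : X × X | p.1 = p.2} :=
    (isClosed_eq continuous_fst continuous_snd).measurableSet
  rw [relIndepSelfJoining, Measure.bind_apply hdiag (κ ×ₖ κ).aemeasurable]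
  have : ∀ᵐ y ∂μ.map π, (κ ×ₖ κ) y {p | p.1 = p.2} = (m : ℝ≥0∞)⁻¹ := by
    filter_upwards [hcard, hunif] with y hy hyu
    have hfinF : (F y).Finite := Set.finite_of_encard_eq_coe hy
    have hcount : Measure.count (F y) = m := by
      rw [Measure.count_apply hfinF.measurableSet, hy]
      simp
    rw [Kernel.prod_apply, Measure.prod_apply hdiag]
    have hsingle : ∀ᵐ x ∂κ y, κ y (Prod.mk x ⁻¹' {p | p.1 = p.2}) = (m : ℝ≥0∞)⁻¹ := by
      have hmem : ∀ᵐ x ∂κ y, x ∈ F y := by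
        rw [hyu]
        exact ae_cond_mem hfinF.measurableSet
      filter_upwards [hmem] with x hx
      have h1 : Prod.mk x ⁻¹' {p : X × X | p.1 = p.2} = {x} := by
        ext z; simp [eq_comm]
      have h2 : F y ∩ {x} = {x} := Set.inter_eq_right.2 (Set.singleton_subset_iff.2 hx)
      rw [h1, hyu, uniformOn, ProbabilityTheory.cond_apply hfinF.measurableSet, hcount, h2,
        Measure.count_singleton, mul_one]
    rw [lintegral_congr_ae hsingle, lintegral_const, measure_univ, mul_one]
  rw [lintegral_congr_ae this, lintegral_const, measure_univ, mul_one]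

/-- Restricting a separating joining to some of its coordinates. -/
lemma exists_joining_of_injective (T : X ≃ᵐ X) {Z : Type*} [TopologicalSpace Z]
    [T2Space Z] {π : X → Z} (hπ : Continuous π) {d m : ℕ}
    {J : Measure (Fin d → X)} (hJ : IsRelJoining T π d J) (hJs : IsSeparating J)
    {f : Fin m → Fin d} (hf : Function.Injective f) :
    ∃ J' : Measure (Fin m → X), IsRelJoining T π m J' ∧ IsSeparating J' ∧
      ∀ i, margin J' i = margin J (f i) := by
  have := hJ.prob
  let p : (Fin d → X) → Fin m → X := fun x i => x (f i)
  have hp : Measurable p := measurable_pi_lambda _ fun i => measurable_pi_apply (f i)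
  have hdiag : ∀ n, Measurable (diagMap T n) := fun n =>
    measurable_pi_lambda _ fun i => T.measurable.comp (measurable_pi_apply i)
  refine ⟨J.map p, ⟨Measure.isProbabilityMeasure_map hp.aemeasurable, ⟨hdiag m, ?_⟩, ?_⟩, ?_,
    fun i => ?_⟩
  · rw [Measure.map_map (hdiag m) hp]
    conv_rhs => rw [← hJ.invariant.map_eq, Measure.map_map hp (hdiag d)]
    rfl
  · have hclosed : IsClosed {x : Fin m → X | ∀ i j, π (x i) = π (x j)} := by
      simp only [Set.ofPred_forall]
      exact isClosed_iInter fun i => isClosed_iInter fun j =>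
        isClosed_eq (hπ.comp (continuous_apply i)) (hπ.comp (continuous_apply j))
    rw [ae_map_iff hp.aemeasurable hclosed.measurableSet]
    exact hJ.same_image.mono fun x hx i j => hx _ _
  · rw [IsSeparating, ae_map_iff hp.aemeasurable (measurableSet_injective m)]
    exact hJs.mono fun x hx => hx.comp hf
  · rw [margin, margin, Measure.map_map (measurable_pi_apply i) hp]
    rfl

variable [CompactSpace X]

/-- For almost every tuple of an ergodic separating joining with as many factors as there are
points in the fibers, the points in the fiber which are generic for `μ` are the entries at those
coordinates whose margin is `μ`. -/
theorem ae_generic_fiber_eq_image (T : X ≃ᵐ X) (hπ : Measurable π) {d : ℕ}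
    {J : Measure (Fin d → X)} (hJ : IsRelJoining T π d J) (hJe : Ergodic (diagMap T d) J)
    (hJs : IsSeparating J) (i₀ : Fin d)
    (hd : ∀ᵐ y ∂(margin J i₀).map π, (π ⁻¹' {y}).encard = d)
    (μ : Measure X) [IsProbabilityMeasure μ] :
    ∀ᵐ x ∂J, genericPoints T μ ∩ π ⁻¹' {π (x i₀)} = x '' {i | margin J i = μ} := by
  have := hJ.prob
  have hmargin : ∀ i, Ergodic T (margin J i) := fun i =>
    (MeasurePreserving.mk (measurable_pi_apply i) rfl).ergodic_of_ergodic_semiconj hJe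
      T.measurable fun x => rfl
  have hprob : ∀ i, IsProbabilityMeasure (margin J i) := fun i =>
    Measure.isProbabilityMeasure_map (measurable_pi_apply i).aemeasurable
  have hgen : ∀ᵐ x ∂J, ∀ i, x i ∈ genericPoints T (margin J i) := ae_all_iff.2 fun i =>
    ae_of_ae_map (measurable_pi_apply i).aemeasurable (ae_mem_genericPoints (hmargin i))
  have hd' : ∀ᵐ x ∂J, (π ⁻¹' {π (x i₀)}).encard = d :=
    ae_of_ae_map (measurable_pi_apply i₀).aemeasurable (ae_of_ae_map hπ.aemeasurable hd)
  filter_upwards [hgen, hd', hJ.same_image, hJs] with x hxg hxd hxπ hxinj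
  have hrange : Set.range x = π ⁻¹' {π (x i₀)} := by
    refine (Set.finite_range x).eq_of_subset_of_encard_le ?_ ?_
    · rintro _ ⟨i, rfl⟩
      exact hxπ i i₀
    · rw [hxd, ← Set.image_univ, hxinj.encard_image, Set.encard_univ, ENat.card_eq_coe_fintype_card,
        Fintype.card_fin]
  ext w
  constructor
  · rintro ⟨hw, hwπ⟩
    rw [← hrange] at hwπ
    obtain ⟨i, rfl⟩ := hwπ
    exact ⟨i, eq_of_mem_genericPoints (hxg i) hw, rfl⟩
  · rintro ⟨i, rfl, rfl⟩
    exact ⟨hxg i, hxπ i i₀⟩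

/-- A separating joining of copies of `μ` consists of distinct generic points in a fiber, so the
number of its factors is bounded by the number of generic points there. -/
lemma card_le_of_separating (T : X ≃ᵐ X) (hπ : Measurable π) {μ : Measure X}
    [IsProbabilityMeasure μ] (hμ : Ergodic T μ) {m n : ℕ}
    (hcard : ∀ᵐ y ∂μ.map π, (genericPoints T μ ∩ π ⁻¹' {y}).encard = m)
    {J : Measure (Fin n → X)} (hJ : IsRelJoining T π n J) (hJs : IsSeparating J)
    (hJμ : ∀ i, margin J i = μ) : n ≤ m := by
  rcases Nat.eq_zero_or_pos n with rfl | hn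
  · exact Nat.zero_le _
  let i₀ : Fin n := ⟨0, hn⟩
  have := hJ.prob
  have hev : ∀ i, Measurable fun x : Fin n → X => x i := measurable_pi_apply
  have hmap : ∀ i, J.map (fun x => x i) = μ := hJμ
  have hgen : ∀ᵐ x ∂J, ∀ i, x i ∈ genericPoints T μ := by
    refine ae_all_iff.2 fun i => ?_
    have h : ∀ᵐ z ∂J.map (fun x => x i), z ∈ genericPoints T μ := by
      rw [hmap i]
      exact ae_mem_genericPoints hμ
    exact ae_of_ae_map (hev i).aemeasurable h
  have hc : ∀ᵐ x ∂J, (genericPoints T μ ∩ π ⁻¹' {π (x i₀)}).encard = m := by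
    have h : ∀ᵐ z ∂J.map (fun x => x i₀), (genericPoints T μ ∩ π ⁻¹' {π z}).encard = m := by
      rw [hmap i₀]
      exact ae_of_ae_map hπ.aemeasurable hcard
    exact ae_of_ae_map (hev i₀).aemeasurable h
  obtain ⟨x, hxg, hxc, hxπ, hxinj⟩ := (hgen.and (hc.and (hJ.same_image.and hJs))).exists
  have hsub : Set.range x ⊆ genericPoints T μ ∩ π ⁻¹' {π (x i₀)} := by
    rintro _ ⟨i, rfl⟩
    exact ⟨hxg i, hxπ i i₀⟩
  have := Set.encard_le_encard hsub
  rw [hxc, ← Set.image_univ, hxinj.encard_image, Set.encard_univ, ENat.card_eq_coe_fintype_card,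
    Fintype.card_fin] at this
  exact_mod_cast this

variable [TopologicalSpace Y] [T2Space Y] [BorelSpace Y]

/-- If almost every fiber has `d` points, then enumerating the fibers yields an ergodic
separating joining. -/
theorem exists_ergodic_separating_joining (T : X ≃ᵐ X) {S : Y → Y} (hS : Function.Injective S)
    (hπ : Continuous π) (hsemi : Function.Semiconj π T S) (hfin : IsFiniteToOne π)
    {ν : Measure Y} [IsProbabilityMeasure ν] (hν : Ergodic S ν) {d : ℕ} (hd0 : 0 < d)
    (hd : ∀ᵐ y ∂ν, (π ⁻¹' {y}).encard = d) :
    ∃ J : Measure (Fin d → X), IsRelJoining T π d J ∧ Ergodic (diagMap T d) J ∧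
      IsSeparating J ∧ ∀ i, (margin J i).map π = ν := by
  let i₀ : Fin d := ⟨0, hd0⟩
  let q : (Fin d → X) → Y := fun x => π (x i₀)
  have hq : Continuous q := hπ.comp (continuous_apply i₀)
  let R : Set (Fin d → X) := {x | ∀ i, π (x i) = q x}
  let I : Set (Fin d → X) := {x | Function.Injective x}
  have hR : IsClosed R := by
    simp only [R, Set.ofPred_forall]
    exact isClosed_iInter fun i => isClosed_eq (hπ.comp (continuous_apply i)) hq
  have hI : MeasurableSet I := measurableSet_injective d
  have hRfin : ∀ y, (R ∩ q ⁻¹' {y}).Finite := fun y =>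
    (Set.Finite.pi fun _ => hfin y).subset fun x hx i _ => (hx.1 i).trans hx.2
  have hmeas : Measurable (fiberCount q (R ∩ I)) :=
    measurable_fiberCount_inter (measurable_fiberCount hq hR hRfin) hI
  let e : (Fin d → X) ≃ᵐ (Fin d → X) := MeasurableEquiv.piCongrRight fun _ => T
  have he : ⇑e = diagMap T d := rfl
  have hinv : e ⁻¹' (R ∩ I) = R ∩ I := by
    ext x
    have h1 : (∀ i, π (T (x i)) = π (T (x i₀))) ↔ ∀ i, π (x i) = π (x i₀) :=
      forall_congr' fun i => by rw [hsemi, hsemi, hS.eq_iff]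
    have h2 : Function.Injective (fun i => T (x i)) ↔ Function.Injective x :=
      T.injective.of_comp_iff x
    exact and_congr h1 h2
  have hne : ∀ᵐ y ∂ν, ((R ∩ I) ∩ q ⁻¹' {y}).Nonempty := by
    filter_upwards [hd] with y hy
    have : Finite (π ⁻¹' {y}) := (hfin y).to_subtype
    have hcard : Nat.card (π ⁻¹' {y}) = d := by
      rw [Nat.card_coe_set_eq, Set.ncard, hy, ENat.toNat_natCast]
    let f := (Finite.equivFinOfCardEq hcard).symm
    have hf : ∀ i, π (f i).1 = y := fun i => (f i).2
    exact ⟨fun i => (f i).1, ⟨fun i => (hf i).trans (hf i₀).symm,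
      Subtype.val_injective.comp f.injective⟩, hf i₀⟩
  obtain ⟨J, hJprob, hJerg, hJq, hJD⟩ := exists_ergodic_lift e hq.measurable hS
    (fun x => hsemi (x i₀)) hν (hR.measurableSet.inter hI) hinv
    (fun y => (hRfin y).subset fun x hx => ⟨hx.1.1, hx.2⟩) hmeas hne
  rw [he] at hJerg
  have hJ : IsRelJoining T π d J := ⟨hJprob, hJerg.toMeasurePreserving,
    hJD.mono fun x hx i j => (hx.1 i).trans (hx.1 j).symm⟩
  refine ⟨J, hJ, hJerg, hJD.mono fun x hx => hx.2, fun i => ?_⟩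
  rw [hJ.map_margin_eq hπ.measurable i i₀, margin,
    Measure.map_map hπ.measurable (measurable_pi_apply i₀)]
  exact hJq

lemma measurable_fiberCount_generic (T : X ≃ᵐ X) (hπ : Continuous π) (hfin : IsFiniteToOne π)
    (μ : Measure X) [IsProbabilityMeasure μ] :
    Measurable (fiberCount π (genericPoints T μ)) := by
  have := measurable_fiberCount_inter (measurable_fiberCount hπ isClosed_univ (D := Set.univ)
    fun y => (hfin y).subset Set.inter_subset_right) (measurableSet_genericPoints T.measurable μ)
  rwa [Set.univ_inter] at this

/-- The integral of the number of generic points in the fibers recovers `μ` up to the number of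
margins equal to `μ`. -/
theorem lintegral_fiberCount_generic (T : X ≃ᵐ X) (hπ : Continuous π) (hfin : IsFiniteToOne π)
    {d : ℕ} {J : Measure (Fin d → X)} (hJ : IsRelJoining T π d J)
    (hJe : Ergodic (diagMap T d) J) (hJs : IsSeparating J) (i₀ : Fin d)
    (hd : ∀ᵐ y ∂(margin J i₀).map π, (π ⁻¹' {y}).encard = d)
    (μ : Measure X) [IsProbabilityMeasure μ] {A : Set X} (hA : MeasurableSet A) :
    ∫⁻ y, fiberCount π (genericPoints T μ) y A ∂(margin J i₀).map π =
      {i | margin J i = μ}.ncard * μ A := by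
  classical
  have hfin' : ∀ y, (genericPoints T μ ∩ π ⁻¹' {y}).Finite := fun y =>
    (hfin y).subset Set.inter_subset_right
  have hmeas := measurable_fiberCount_generic T hπ hfin μ
  have hev : Measurable fun y => fiberCount π (genericPoints T μ) y A :=
    (Measure.measurable_coe hA).comp hmeas
  have hev' : Measurable fun x => fiberCount π (genericPoints T μ) (π x) A :=
    hev.comp hπ.measurable
  let I : Finset (Fin d) := Finset.univ.filter fun i => margin J i = μ
  have hI : {i | margin J i = μ} = (I : Set (Fin d)) := by ext; simp [I]
  rw [margin, lintegral_map hev hπ.measurable,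
    lintegral_map hev' (measurable_pi_apply i₀)]
  have hae : ∀ᵐ x ∂J, fiberCount π (genericPoints T μ) (π (x i₀)) A =
      ∑ i ∈ I, A.indicator (fun _ => (1 : ℝ≥0∞)) (x i) := by
    filter_upwards [ae_generic_fiber_eq_image T hπ.measurable hJ hJe hJs i₀ hd μ, hJs]
      with x hx hxinj
    rw [fiberCount_apply _ _ _ hA (hfin' _), hx, hI]
    have h1 : A ∩ x '' (I : Set (Fin d)) = x '' ((I.filter fun i => x i ∈ A : Finset (Fin d)) :
        Set (Fin d)) := by
      ext w
      simp only [Set.mem_inter_iff, Set.mem_image, Finset.coe_filter, Finset.mem_coe,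
        Set.mem_ofPred_eq]
      constructor
      · rintro ⟨hw, i, hi, rfl⟩; exact ⟨i, ⟨hi, hw⟩, rfl⟩
      · rintro ⟨i, ⟨hi, hw⟩, rfl⟩; exact ⟨hw, i, hi, rfl⟩
    rw [h1, hxinj.encard_image, Set.encard_coe_eq_coe_finsetCard, Finset.card_filter]
    simp [Set.indicator_apply]
  rw [lintegral_congr_ae hae, lintegral_finsetSum]
  · have h2 : ∀ i ∈ I, ∫⁻ x, A.indicator (fun _ => (1 : ℝ≥0∞)) (x i) ∂J = μ A := by
      intro i hi
      have hi' : margin J i = μ := (Finset.mem_filter.1 hi).2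
      rw [← hi', margin, ← lintegral_map (measurable_const.indicator hA) (measurable_pi_apply i),
        lintegral_indicator_const hA, one_mul]
    rw [Finset.sum_congr rfl h2, Finset.sum_const, hI, Set.ncard_coe_finset, nsmul_eq_mul]
  · exact fun i _ => (measurable_const.indicator hA).comp (measurable_pi_apply i)

/-- Almost every fiber contains as many generic points for `μ` as there are margins equal to `μ` in
an ergodic separating joining enumerating the fibers. -/
theorem ae_encard_generic_fiber (T : X ≃ᵐ X) (hπ : Continuous π) (hfin : IsFiniteToOne π)
    {d : ℕ} {J : Measure (Fin d → X)} (hJ : IsRelJoining T π d J)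
    (hJe : Ergodic (diagMap T d) J) (hJs : IsSeparating J) (i₀ : Fin d)
    (hd : ∀ᵐ y ∂(margin J i₀).map π, (π ⁻¹' {y}).encard = d)
    (μ : Measure X) [IsProbabilityMeasure μ] :
    ∀ᵐ y ∂(margin J i₀).map π,
      (genericPoints T μ ∩ π ⁻¹' {y}).encard = {i | margin J i = μ}.ncard := by
  have hev : Measurable fun y => fiberCount π (genericPoints T μ) y Set.univ :=
    (Measure.measurable_coe .univ).comp (measurable_fiberCount_generic T hπ hfin μ)
  have hset : MeasurableSet {y | (genericPoints T μ ∩ π ⁻¹' {y}).encard =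
      ({i | margin J i = μ}.ncard : ℕ∞)} := by
    convert hev (measurableSet_singleton ({i | margin J i = μ}.ncard : ℝ≥0∞)) using 1
    ext y
    simp only [Set.mem_ofPred_eq, Set.mem_preimage,
      fiberCount_univ ((hfin y).subset Set.inter_subset_right), Set.mem_singleton_iff]
    norm_cast
  have hset' : MeasurableSet {x | (genericPoints T μ ∩ π ⁻¹' {π x}).encard =
      ({i | margin J i = μ}.ncard : ℕ∞)} := hπ.measurable hset
  rw [ae_map_iff hπ.measurable.aemeasurable hset, margin]
  have hev₀ : Measurable fun x : Fin d → X => x i₀ := measurable_pi_apply i₀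
  refine (ae_map_iff hev₀.aemeasurable hset').2 ?_
  filter_upwards [ae_generic_fiber_eq_image T hπ.measurable hJ hJe hJs i₀ hd μ, hJs]
    with x hx hxinj
  rw [hx, hxinj.encard_image, (Set.toFinite _).cast_ncard_eq]

/-- If almost every fiber contains `m` generic points for `μ`, and counting them recovers `μ` up to
the factor `m`, then `μ` disintegrates into the uniform distributions on them. -/
theorem exists_disintegration_uniformOn (T : X ≃ᵐ X) (hπ : Continuous π)
    (hfin : IsFiniteToOne π) (μ : Measure X) [IsProbabilityMeasure μ] {m : ℕ} (hm : m ≠ 0)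
    (hcard : ∀ᵐ y ∂μ.map π, (genericPoints T μ ∩ π ⁻¹' {y}).encard = m)
    (hcount : ∀ A, MeasurableSet A →
      ∫⁻ y, fiberCount π (genericPoints T μ) y A ∂μ.map π = m * μ A) :
    ∃ κ : Kernel Y X, IsDisintegration π μ κ ∧
      ∀ᵐ y ∂μ.map π, κ y = uniformOn (genericPoints T μ ∩ π ⁻¹' {y}) := by
  classical
  have hne : Nonempty X := by
    by_contra hX
    rw [not_nonempty_iff] at hX
    exact IsProbabilityMeasure.ne_zero μ (Measure.eq_zero_of_isEmpty μ)
  obtain ⟨x₀⟩ := hne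
  have hmE : (m : ℝ≥0∞) ≠ 0 := by exact_mod_cast hm
  have hmT : (m : ℝ≥0∞) ≠ ∞ := ENNReal.natCast_ne_top m
  set G := genericPoints T μ with hG
  have hmeas := measurable_fiberCount_generic T hπ hfin μ
  have hev : ∀ A, MeasurableSet A → Measurable fun y => fiberCount π G y A := fun A hA =>
    (Measure.measurable_coe hA).comp hmeas
  have huniv : ∀ y, fiberCount π G y Set.univ = (G ∩ π ⁻¹' {y}).encard :=
    fun y => fiberCount_univ ((hfin y).subset Set.inter_subset_right)
  let Q : Set Y := {y | fiberCount π G y Set.univ = m}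
  have hQ : MeasurableSet Q := hev _ .univ (measurableSet_singleton _)
  let κ₁ : Kernel Y X := ⟨fun y => (m : ℝ≥0∞)⁻¹ • fiberCount π G y,
    Measure.measurable_of_measurable_coe _ fun A hA => (hev A hA).const_mul _⟩
  let κ : Kernel Y X := Kernel.piecewise hQ κ₁ (Kernel.const Y (Measure.dirac x₀))
  have hκQ : ∀ y ∈ Q, κ y = (m : ℝ≥0∞)⁻¹ • fiberCount π G y := fun y hy => by
    rw [Kernel.piecewise_apply, if_pos hy]
    rfl
  have hQae : ∀ᵐ y ∂μ.map π, y ∈ Q := by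
    filter_upwards [hcard] with y hy
    change fiberCount π G y Set.univ = m
    rw [huniv, hy]
    simp
  have hfinG : ∀ y, (G ∩ π ⁻¹' {y}).Finite := fun y => (hfin y).subset Set.inter_subset_right
  refine ⟨κ, ⟨⟨fun y => ⟨?_⟩⟩, ?_, ?_⟩, ?_⟩
  · by_cases hy : y ∈ Q
    · rw [hκQ y hy, Measure.smul_apply, show fiberCount π G y Set.univ = m from hy, smul_eq_mul,
        ENNReal.inv_mul_cancel hmE hmT]
    · rw [Kernel.piecewise_apply, if_neg hy, Kernel.const_apply, measure_univ]
  · ext A hA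
    rw [Measure.bind_apply hA κ.aemeasurable]
    have : ∀ᵐ y ∂μ.map π, κ y A = (m : ℝ≥0∞)⁻¹ * fiberCount π G y A := by
      filter_upwards [hQae] with y hy
      rw [hκQ y hy, Measure.smul_apply, smul_eq_mul]
    rw [lintegral_congr_ae this, lintegral_const_mul _ (hev A hA), hcount A hA, ← mul_assoc,
      ENNReal.inv_mul_cancel hmE hmT, one_mul]
  · filter_upwards [hQae] with y hy
    have hy' : fiberCount π G y (π ⁻¹' {y}) = fiberCount π G y Set.univ := by
      rw [huniv, fiberCount_apply _ _ _ (hπ.measurable (measurableSet_singleton y)) (hfinG y),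
        Set.inter_eq_right.2 Set.inter_subset_right]
    rw [hκQ y hy, Measure.smul_apply, hy', show fiberCount π G y Set.univ = m from hy, smul_eq_mul,
      ENNReal.inv_mul_cancel hmE hmT]
  · filter_upwards [hQae] with y hy
    rw [hκQ y hy, uniformOn, ProbabilityTheory.cond, Measure.count_apply (hfinG y).measurableSet,
      ← huniv y, show fiberCount π G y Set.univ = m from hy]
    rfl

end Joinings

/-! ### Almost every point of a shift space is doubly transitive -/

/-- Almost every orbit of an ergodic map visits a given set of positive measure infinitely
often. -/
lemma ae_frequently_mem {X : Type*} [MeasurableSpace X] {T : X → X} {μ : Measure X}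
    [IsFiniteMeasure μ] (hT : Ergodic T μ) {U : Set X} (hU : MeasurableSet U) (hμU : μ U ≠ 0) :
    ∀ᵐ x ∂μ, ∃ᶠ n in atTop, T^[n] x ∈ U := by
  have hmeas : MeasurableSet {x | ∃ᶠ n in atTop, T^[n] x ∈ U} := by
    have : {x | ∃ᶠ n in atTop, T^[n] x ∈ U} = ⋂ N : ℕ, ⋃ n : ℕ, ⋃ _ : N ≤ n, T^[n] ⁻¹' U := by
      ext x
      simp [frequently_atTop]
    rw [this]
    exact .iInter fun N => .iUnion fun n => .iUnion fun _ => (hT.measurable.iterate n) hU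
  have hinv : T ⁻¹' {x | ∃ᶠ n in atTop, T^[n] x ∈ U} = {x | ∃ᶠ n in atTop, T^[n] x ∈ U} := by
    ext x
    have h := frequently_map (m := fun n => n + 1) (f := atTop) (P := fun n => T^[n] x ∈ U)
    rw [map_add_atTop_eq_nat] at h
    exact h.symm
  rcases hT.toPreErgodic.ae_mem_or_ae_notMem hmeas hinv with h | h
  · exact h
  · refine absurd (measure_eq_zero_iff_ae_notMem.2 ?_) hμU
    filter_upwards [h, hT.toMeasurePreserving.conservative.ae_mem_imp_frequently_image_mem
      hU.nullMeasurableSet] with x hx hx' hxU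
    exact hx (hx' hxU)

section Shift

variable {A : Type*} [TopologicalSpace A] [MeasurableSpace A] (X : Subshift A ℤ)

lemma measurable_shift_restrict (g : ℤ) :
    Measurable fun x : X.carrier => (⟨shift g x.1, X.mapsTo g x.2⟩ : X.carrier) := by
  refine Measurable.subtype_mk (measurable_pi_lambda _ fun h => ?_)
  exact (measurable_pi_apply (g + h)).comp measurable_subtype_coe

/-- The shift as an invertible measurable map. -/
def shiftEquiv : X.carrier ≃ᵐ X.carrier where
  toFun := shiftMap X
  invFun x := ⟨shift (-1) x.1, X.mapsTo (-1) x.2⟩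
  left_inv x := by
    ext h
    change x.1 (1 + (-1 + h)) = x.1 h
    exact congrArg x.1 (by ring)
  right_inv x := by
    ext h
    change x.1 (-1 + (1 + h)) = x.1 h
    exact congrArg x.1 (by ring)
  measurable_toFun := measurable_shift_restrict X 1
  measurable_invFun := measurable_shift_restrict X (-1)

lemma shiftEquiv_iterate_apply (n : ℕ) (x : X.carrier) (i : ℤ) :
    ((shiftEquiv X)^[n] x).1 i = x.1 (i + n) := by
  induction n generalizing x with
  | zero => simp
  | succ n ih =>
    rw [Function.iterate_succ_apply, ih]
    change x.1 (1 + (i + n)) = _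
    exact congrArg x.1 (by push_cast; ring)

lemma shiftEquiv_symm_iterate_apply (n : ℕ) (x : X.carrier) (i : ℤ) :
    ((shiftEquiv X).symm^[n] x).1 i = x.1 (i - n) := by
  induction n generalizing x with
  | zero => simp
  | succ n ih =>
    rw [Function.iterate_succ_apply, ih]
    change x.1 (-1 + (i - n)) = _
    exact congrArg x.1 (by push_cast; ring)

/-- For a fully supported ergodic measure on a shift space, almost every point is doubly
transitive. -/
theorem ae_isDoublyTransitive [Finite A] [DiscreteTopology A] [BorelSpace A]
    (μ : Measure X.carrier) [IsFiniteMeasure μ] [μ.IsOpenPosMeasure]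
    (hμ : Ergodic (shiftMap X) μ) : ∀ᵐ x ∂μ, IsDoublyTransitive X x := by
  have hT : Ergodic (shiftEquiv X) μ := hμ
  have hword : ∀ w : List A, ∀ᵐ x ∂μ, w ∈ language X →
      (∀ N : ℤ, ∃ i : ℤ, N ≤ i ∧ WordAt x.1 w i) ∧ ∀ N : ℤ, ∃ i : ℤ, i ≤ N ∧ WordAt x.1 w i := by
    intro w
    by_cases hw : w ∈ language X
    swap
    · exact .of_forall fun x h => absurd h hw
    let U : Set X.carrier := {x | WordAt x.1 w 0}
    have hUopen : IsOpen U := by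
      simp only [U, WordAt, Set.ofPred_forall]
      refine isOpen_iInter_of_finite fun k => ?_
      have hc : Continuous fun x : X.carrier => x.1 (0 + (k : ℕ)) :=
        (continuous_apply _).comp continuous_subtype_val
      exact (isOpen_discrete {w.get k}).preimage hc
    have hUne : U.Nonempty := by
      obtain ⟨x, hx, i, hi⟩ := hw
      refine ⟨⟨shift i x, X.mapsTo i hx⟩, fun k => ?_⟩
      rw [zero_add]
      exact hi k
    have hμU : μ U ≠ 0 := (hUopen.measure_pos μ hUne).ne'
    filter_upwards [ae_frequently_mem hT hUopen.measurableSet hμU,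
      ae_frequently_mem hT.symm hUopen.measurableSet hμU] with x hx hx' _
    constructor
    · intro N
      obtain ⟨n, hn, hnU⟩ := frequently_atTop.1 hx N.toNat
      refine ⟨n, by omega, fun k => ?_⟩
      rw [← hnU k, shiftEquiv_iterate_apply]
      exact congrArg x.1 (by ring)
    · intro N
      obtain ⟨n, hn, hnU⟩ := frequently_atTop.1 hx' (-N).toNat
      refine ⟨-n, by omega, fun k => ?_⟩
      rw [← hnU k, shiftEquiv_symm_iterate_apply]
      exact congrArg x.1 (by ring)
  exact (ae_all_iff.2 hword).mono fun x hx w => hx w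

end Shift

end SoficMultiplicity

open SoficMultiplicity in
theorem mainTheorem6 {A B : Type*}
    [Finite A] [TopologicalSpace A] [DiscreteTopology A] [MeasurableSpace A] [BorelSpace A]
    [Finite B] [TopologicalSpace B] [DiscreteTopology B] [MeasurableSpace B] [BorelSpace B]
    (X : Subshift A ℤ) (Y : Subshift B ℤ)
    (hXirr : SoficMultiplicity.IsIrreducible X) (hXsofic : SoficMultiplicity.IsSofic X)
    (π : X.carrier → Y.carrier) (hπ : SoficMultiplicity.IsFactorCode π)
    (hfin : SoficMultiplicity.IsFiniteToOne π)
    (μ : Measure X.carrier) [IsProbabilityMeasure μ] [μ.IsOpenPosMeasure]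
    (hμ : Ergodic (SoficMultiplicity.shiftMap X) μ) :
    ∃ m : ℕ, SoficMultiplicity.IsMultiplicity π μ m ∧
      (∃ κ : Kernel Y.carrier X.carrier, SoficMultiplicity.IsDisintegration π μ κ) ∧
      (∀ κ : Kernel Y.carrier X.carrier, SoficMultiplicity.IsDisintegration π μ κ →
        ∀ᵐ y ∂(μ.map π),
          (SoficMultiplicity.genericPoints (SoficMultiplicity.shiftMap X) μ ∩ π ⁻¹' {y}).encard
              = m ∧
          κ y = uniformOn
            (SoficMultiplicity.genericPoints (SoficMultiplicity.shiftMap X) μ ∩ π ⁻¹' {y})) ∧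
      IsGreatest {n : ℕ | ∃ J : Measure (Fin n → X.carrier),
        SoficMultiplicity.IsRelJoining (SoficMultiplicity.shiftMap X) π n J ∧
        SoficMultiplicity.IsSeparating J ∧
        ∀ i, SoficMultiplicity.margin J i = μ} m ∧
      (∀ κ : Kernel Y.carrier X.carrier, SoficMultiplicity.IsDisintegration π μ κ →
        SoficMultiplicity.relIndepSelfJoining π μ κ {p | p.1 = p.2} = (m : ℝ≥0∞)⁻¹) := by
  classical
  have : CompactSpace X.carrier := isCompact_iff_compactSpace.1 X.isClosed.isCompact
  let T := shiftEquiv X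
  have hT : Ergodic T μ := hμ
  have hπm : Measurable π := hπ.continuous.measurable
  have hνprob := Measure.isProbabilityMeasure_map (μ := μ) hπm.aemeasurable
  have hνpos : (μ.map π).IsOpenPosMeasure :=
    hπ.continuous.isOpenPosMeasure_map hπ.surjective
  have hν : Ergodic (shiftMap Y) (μ.map π) :=
    (MeasurePreserving.mk hπm rfl).ergodic_of_ergodic_semiconj hμ
      (shiftEquiv Y).measurable hπ.semiconj
  -- full support makes the doubly transitive points conull, so that there are such points in `X`
  obtain ⟨x₀, hx₀⟩ := (ae_isDoublyTransitive X μ hμ).exists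
  have hd : ∀ᵐ y ∂μ.map π, (π ⁻¹' {y}).encard = degree π :=
    (ae_isDoublyTransitive Y (μ.map π) hν).mono fun y hy =>
      hπ.encard_fiber_eq_degree hfin hXsofic hx₀ hy
  have hd0 : 0 < degree π := by
    obtain ⟨y, hy⟩ := hd.exists
    obtain ⟨x, hx⟩ := hπ.surjective y
    refine Nat.pos_of_ne_zero fun h => ?_
    rw [h, Nat.cast_zero, Set.encard_eq_zero] at hy
    exact (hy ▸ hx : x ∈ (∅ : Set X.carrier))
  obtain ⟨J, hJ, hJe, hJs, hJν⟩ := exists_ergodic_separating_joining T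
    (shiftEquiv Y).injective hπ.continuous hπ.semiconj hfin hν hd0 hd
  let i₀ : Fin (degree π) := ⟨0, hd0⟩
  have hJd : ∀ᵐ y ∂(margin J i₀).map π, (π ⁻¹' {y}).encard = degree π := by rwa [hJν i₀]
  obtain ⟨m, hm⟩ : ∃ m, {i | margin J i = μ}.ncard = m := ⟨_, rfl⟩
  have hcard : ∀ᵐ y ∂μ.map π, (genericPoints T μ ∩ π ⁻¹' {y}).encard = m := by
    have := ae_encard_generic_fiber T hπ.continuous hfin hJ hJe hJs i₀ hJd μ
    rwa [hJν i₀, hm] at this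
  -- `μ`-almost every `x` is itself a generic point in its fiber
  have hm0 : m ≠ 0 := by
    rintro rfl
    obtain ⟨x, hx, hxg⟩ := ((ae_of_ae_map hπm.aemeasurable hcard).and
      (ae_mem_genericPoints hT)).exists
    rw [Nat.cast_zero, Set.encard_eq_zero] at hx
    exact (hx ▸ ⟨hxg, rfl⟩ : x ∈ (∅ : Set X.carrier))
  have hcount : ∀ A, MeasurableSet A →
      ∫⁻ y, fiberCount π (genericPoints T μ) y A ∂μ.map π = m * μ A := by
    intro A hA
    have := lintegral_fiberCount_generic T hπ.continuous hfin hJ hJe hJs i₀ hJd μ hA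
    rwa [hJν i₀, hm] at this
  obtain ⟨κ₀, hκ₀, hκ₀u⟩ := exists_disintegration_uniformOn T hπ.continuous hfin μ hm0 hcard hcount
  have hunif : ∀ κ : Kernel Y.carrier X.carrier, IsDisintegration π μ κ →
      ∀ᵐ y ∂μ.map π, κ y = uniformOn (genericPoints T μ ∩ π ⁻¹' {y}) := fun κ hκ => by
    filter_upwards [hκ.ae_eq hπm hκ₀, hκ₀u] with y hy hy'
    rw [hy, hy']
  refine ⟨m, ⟨⟨J, hJ, ⟨i₀, hJν i₀⟩, hJe, hJs⟩, fun J' hJ' => ?_⟩, ⟨κ₀, hκ₀⟩,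
    fun κ hκ => hcard.and (hunif κ hκ), ⟨?_, ?_⟩,
    fun κ hκ => relIndepSelfJoining_diagonal hπm hκ hcard (hunif κ hκ)⟩
  · -- both joinings count the generic points in almost every fiber
    obtain ⟨i, hi⟩ := hJ'.image
    have hJd' : ∀ᵐ y ∂(margin J' i).map π, (π ⁻¹' {y}).encard = degree π := by rwa [hi]
    have hcard' := ae_encard_generic_fiber T hπ.continuous hfin hJ'.relJoining hJ'.ergodic
      hJ'.separating i hJd' μ
    rw [hi] at hcard'
    obtain ⟨y, hy, hy'⟩ := (hcard.and hcard').exists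
    exact_mod_cast hy'.symm.trans hy
  · have hm' : Nat.card {i | margin J i = μ} = m := by rw [Nat.card_coe_set_eq, hm]
    let f := (Finite.equivFinOfCardEq hm').symm
    obtain ⟨J', hJ', hJs', hJm'⟩ := exists_joining_of_injective T hπ.continuous hJ hJs
      (f := fun i => (f i).1) (Subtype.val_injective.comp f.injective)
    exact ⟨J', hJ', hJs', fun i => (hJm' i).trans (f i).2⟩
  · rintro n ⟨J', hJ', hJs', hJμ'⟩
    exact card_le_of_separating T hπm hT hcard hJ' hJs' hJμ'
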